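/- **Setting.** Let $d\in\mathbf N$, $T>0$, $H_T=[0,T]\times\mathbf R^d$, $\lambda\ge 0$, $\beta>0$. *Lévy measure.* Let $\nu$ be a Lévy measure on $\mathbf R^d\setminus\{0\}$, i.e. $\int (1\wedge|y|^2)\,\nu(dy)<\infty$, whose order $$\alpha=\inf\Big\{\sigma\in(0,2):\int_{|y|\le 1}|y|^\sigma\,\nu(dy)<\infty\Big\}$$ lies in $(0,2)$; if $\alpha>1$, assume also $\int_{|y|>1}|y|\,\nu(dy)<\infty$. Put $\chi_\alpha(y)=1_{\alpha\in(1,2)}+1_{\alpha=1}1_{|y|\le1}$ and $$L^\nu\varphi(x)=\int\big[\varphi(x+y)-\varphi(x)-\chi_\alpha(y)\,y\cdot\nabla\varphi(x)\big]\,\nu(dy).$$ *Lévy process.* Let $J(ds,dy)$ be a Poisson random measure on $[0,\infty)\times(\mathbf R^d\setminus\{0\})$ with intensity $\nu(dy)\,ds$, defined on a probability space $(\Omega,\mathcal F,\mathbf P)$, let $\tilde J(ds,dy)=J(ds,dy)-\nu(dy)\,ds$, and let $$Z^\nu_t=\int_0^t\!\!\int\chi_\alpha(y)\,y\,\tilde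 J(ds,dy)+\int_0^t\!\!\int(1-\chi_\alpha(y))\,y\,J(ds,dy),\qquad t\ge0,$$ where the compensated integral is the limit in probability, as $\varepsilon\downarrow0$, of the compensated integrals over $\{|y|>\varepsilon\}$. *Function spaces.* $C_b^\infty(H_T)$ is the set of $u:H_T\to\mathbf R$ whose partial derivatives in $x$ of every order (order $0$ included) exist, are continuous on $H_T$ and are bounded on $H_T$. Let $w:(0,\infty)\to(0,\infty)$ be continuous with $w(r)\to0$ as $r\to0$ and $w(r)\to\infty$ as $r\to\infty$, and let $l$ be a continuous nondecreasing function on $(0,\infty)$ with $l(\varepsilon)\to0$ as $\varepsilon\to0$ and $w(\varepsilon r)\le l(\varepsilon)w(r)$ for all $r,\varepsilon>0$. Let $N>3$ satisfy $l(N^{-1})<1<l(N)$, and let $\phi\in C_0^\infty(\mathbf R^d)$ have support $\{N^{-1}\le|\xi|\le N\}$, be positive for $N^{-1}<|\xi|<N$, and satisfy $\sum_{j\in\mathbf Z}\phi(N^{-j}\xi)=1$ for $\xi\ne0$. Put $\varphi_j=\mathcal F^{-1}[\phi(N^{-j}\cdot)]$ for $j\ge1$ and $\varphi_0=\mathcal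 F^{-1}\big[1-\sum_{j\ge1}\phi(N^{-j}\cdot)\big]$, where $\mathcal F^{-1}g(x)=\int e^{i2\pi x\cdot\xi}g(\xi)\,d\xi$. A function $f\in C_b^\infty(H_T)$ belongs to $\tilde C^\beta_{\infty,\infty}(H_T)$ if $$|f|_{\beta,\infty}=\sup_{j\ge0}\,w(N^{-j})^{-\beta}\sup_{(t,x)\in H_T}\big|(f(t,\cdot)*\varphi_j)(x)\big|<\infty .$$ **Theorem.** Let $f\in C_b^\infty(H_T)\cap\tilde C^\beta_{\infty,\infty}(H_T)$. Then there is exactly one $u\in C_b^\infty(H_T)$ such that $$\partial_tu(t,x)=L^\nu u(t,x)-\lambda u(t,x)+f(t,x),\qquad u(0,x)=0,\qquad (t,x)\in H_T$$ (with one-sided time derivatives at $t=0$ and $t=T$), and it is given by $$u(t,x)=\int_0^te^{-\lambda(t-s)}\,\mathbf E f\big(s,x+Z^\nu_{t-s}\big)\,ds,\qquad (t,x)\in H_T.$$ -/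

import Mathlib

open MeasureTheory ProbabilityTheory Set Filter Topology
open scoped ENNReal NNReal FourierTransform

noncomputable section

namespace LevyCauchy

/-! ### Lévy measures and the associated operator -/

section Levy

variable {d : ℕ}

/-- A Lévy measure on `ℝᵈ ∖ {0}`, viewed as a measure on `ℝᵈ` without mass at the origin. -/
structure IsLevyMeasure (ν : Measure (EuclideanSpace ℝ (Fin d))) : Prop where
  zero : ν {0} = 0
  lintegral_lt_top : ∫⁻ y, ENNReal.ofReal (min 1 (‖y‖ ^ 2)) ∂ν < ∞

/-- The order `α = inf {σ ∈ (0,2) : ∫_{|y| ≤ 1} |y|^σ ν(dy) < ∞}`. The (real) infimum of the empty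
set is `0`, so `0 < levyOrder ν` includes the information that the set is nonempty. -/
def levyOrder (ν : Measure (EuclideanSpace ℝ (Fin d))) : ℝ :=
  sInf {σ : ℝ | σ ∈ Ioo (0 : ℝ) 2 ∧
    ∫⁻ y in {y : EuclideanSpace ℝ (Fin d) | ‖y‖ ≤ 1}, ENNReal.ofReal (‖y‖ ^ σ) ∂ν < ∞}

open Classical in
/-- `χ_α(y) = 1_{α ∈ (1,2)} + 1_{α = 1} 1_{|y| ≤ 1}`. -/
def chi (α : ℝ) (y : EuclideanSpace ℝ (Fin d)) : ℝ :=
  (if α ∈ Ioo (1 : ℝ) 2 then 1 else 0) + (if α = 1 ∧ ‖y‖ ≤ 1 then 1 else 0)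

/-- `L^ν φ(x) = ∫ [φ(x+y) - φ(x) - χ_α(y) y · ∇φ(x)] ν(dy)`, where `α` is the order of `ν`. -/
def levyOp (ν : Measure (EuclideanSpace ℝ (Fin d))) (φ : EuclideanSpace ℝ (Fin d) → ℝ)
    (x : EuclideanSpace ℝ (Fin d)) : ℝ :=
  ∫ y, (φ (x + y) - φ x - chi (levyOrder ν) y * fderiv ℝ φ x y) ∂ν

end Levy

/-! ### Poisson random measures and the associated Lévy process -/

/-- `J` is a Poisson random measure with intensity measure `m` on the probability space `(Ω, P)`. -/
structure IsPoissonRandomMeasure {Ω X : Type*} [MeasurableSpace Ω] [MeasurableSpace X]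
    (P : Measure Ω) (m : Measure X) (J : Ω → Measure X) : Prop where
  measurable : Measurable J
  map_eq : ∀ B : Set X, MeasurableSet B → m B < ∞ →
    P.map (fun ω => J ω B) = (poissonMeasure (m B).toNNReal).map (fun n : ℕ => (n : ℝ≥0∞))
  indep : ∀ (n : ℕ) (B : Fin n → Set X), (∀ i, MeasurableSet (B i)) →
    Pairwise (fun i j => Disjoint (B i) (B j)) → iIndepFun (fun i ω => J ω (B i)) P

section Jumps

variable {d : ℕ} {Ω : Type*} [MeasurableSpace Ω]

/-- The measure `ν(dy) ds` on `[0,∞) × ℝᵈ`. -/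
def levyIntensity (ν : Measure (EuclideanSpace ℝ (Fin d))) :
    Measure (ℝ × EuclideanSpace ℝ (Fin d)) :=
  (volume.restrict (Ici (0 : ℝ))).prod ν

/-- `Y` is the compensated integral `∫_0^t ∫ g(y) (J(ds,dy) - ν(dy) ds)`, i.e. the limit in
probability, as `ε ↓ 0`, of the compensated integrals over the jumps of size larger than `ε`. -/
def IsCompensatedIntegral (P : Measure Ω) (ν : Measure (EuclideanSpace ℝ (Fin d)))
    (J : Ω → Measure (ℝ × EuclideanSpace ℝ (Fin d)))
    (g : EuclideanSpace ℝ (Fin d) → EuclideanSpace ℝ (Fin d)) (t : ℝ)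
    (Y : Ω → EuclideanSpace ℝ (Fin d)) : Prop :=
  TendstoInMeasure P
    (fun (ε : ℝ) (ω : Ω) =>
      (∫ p in Ioc (0 : ℝ) t ×ˢ {y : EuclideanSpace ℝ (Fin d) | ε < ‖y‖}, g p.2 ∂(J ω))
        - t • ∫ y in {y : EuclideanSpace ℝ (Fin d) | ε < ‖y‖}, g y ∂ν)
    (𝓝[>] (0 : ℝ)) Y

/-- `Z` is the Lévy process
`Z_t = ∫_0^t ∫ χ_α(y) y (J(ds,dy) - ν(dy) ds) + ∫_0^t ∫ (1 - χ_α(y)) y J(ds,dy)`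
driven by the Poisson random measure `J` with intensity `ν(dy) ds`; `α` is the order of `ν`. -/
structure IsLevyProcessOf (P : Measure Ω) (ν : Measure (EuclideanSpace ℝ (Fin d)))
    (J : Ω → Measure (ℝ × EuclideanSpace ℝ (Fin d)))
    (Z : ℝ → Ω → EuclideanSpace ℝ (Fin d)) : Prop where
  poisson : IsPoissonRandomMeasure P (levyIntensity ν) J
  aemeasurable : ∀ t, 0 ≤ t → AEMeasurable (Z t) P
  eq_integral : ∀ t, 0 ≤ t → ∃ Y : Ω → EuclideanSpace ℝ (Fin d),
    IsCompensatedIntegral P ν J (fun y => chi (levyOrder ν) y • y) t Y ∧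
    ∀ᵐ ω ∂P, Z t ω = Y ω +
      ∫ p in Ioc (0 : ℝ) t ×ˢ (univ : Set (EuclideanSpace ℝ (Fin d))),
        (1 - chi (levyOrder ν) p.2) • p.2 ∂(J ω)

end Jumps

/-! ### Function spaces -/

section Spaces

variable {d : ℕ}

/-- `C_b^∞(H_T)`, `H_T = [0,T] × ℝᵈ`: functions all of whose derivatives in `x` (of every order,
including order zero) exist, are continuous on `H_T` and are bounded on `H_T`. -/
structure IsCbInf (T : ℝ) (u : ℝ → EuclideanSpace ℝ (Fin d) → ℝ) : Prop where
  contDiff : ∀ t ∈ Icc (0 : ℝ) T, ContDiff ℝ ((⊤ : ℕ∞) : WithTop ℕ∞) (u t)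
  continuousOn : ∀ k : ℕ, ContinuousOn
    (fun p : ℝ × EuclideanSpace ℝ (Fin d) => iteratedFDeriv ℝ k (u p.1) p.2)
    (Icc (0 : ℝ) T ×ˢ univ)
  bounded : ∀ k : ℕ, ∃ C : ℝ, ∀ t ∈ Icc (0 : ℝ) T, ∀ x, ‖iteratedFDeriv ℝ k (u t) x‖ ≤ C

/-- `w` is a scaling function with scaling factor `l` (both considered on `(0,∞)` only). -/
structure IsScalingFunction (w l : ℝ → ℝ) : Prop where
  continuousOn : ContinuousOn w (Ioi 0)
  pos : ∀ r, 0 < r → 0 < w r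
  tendsto_zero : Tendsto w (𝓝[>] 0) (𝓝 0)
  tendsto_atTop : Tendsto w atTop atTop
  factor_continuousOn : ContinuousOn l (Ioi 0)
  factor_monotoneOn : MonotoneOn l (Ioi 0)
  factor_tendsto_zero : Tendsto l (𝓝[>] 0) (𝓝 0)
  scale : ∀ r ε, 0 < r → 0 < ε → w (ε * r) ≤ l ε * w r

/-- `ϕ ∈ C_0^∞(ℝᵈ)` generates a Littlewood-Paley partition of unity with ratio `N`: its support is
`{1/N ≤ |ξ| ≤ N}`, it is positive in the interior, and `∑_{j ∈ ℤ} ϕ(N^{-j} ξ) = 1` for `ξ ≠ 0`. -/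
structure IsLittlewoodPaley (N : ℝ) (ϕ : EuclideanSpace ℝ (Fin d) → ℝ) : Prop where
  contDiff : ContDiff ℝ ((⊤ : ℕ∞) : WithTop ℕ∞) ϕ
  tsupport_eq : tsupport ϕ = {ξ | N⁻¹ ≤ ‖ξ‖ ∧ ‖ξ‖ ≤ N}
  pos : ∀ ξ, N⁻¹ < ‖ξ‖ → ‖ξ‖ < N → 0 < ϕ ξ
  hasSum : ∀ ξ, ξ ≠ 0 → HasSum (fun j : ℤ => ϕ (N ^ (-j) • ξ)) 1

/-- `φ_j = 𝓕⁻¹[ϕ(N^{-j} ·)]` for `j ≥ 1` and `φ_0 = 𝓕⁻¹[1 - ∑_{j ≥ 1} ϕ(N^{-j} ·)]`. -/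
def lpKernel (N : ℝ) (ϕ : EuclideanSpace ℝ (Fin d) → ℝ) :
    ℕ → EuclideanSpace ℝ (Fin d) → ℂ
  | 0 => 𝓕⁻ (fun ξ : EuclideanSpace ℝ (Fin d) =>
      ((1 - ∑' j : ℕ, ϕ (N ^ (-((j : ℤ) + 1)) • ξ) : ℝ) : ℂ))
  | (j + 1) => 𝓕⁻ (fun ξ : EuclideanSpace ℝ (Fin d) =>
      ((ϕ (N ^ (-((j : ℤ) + 1)) • ξ) : ℝ) : ℂ))

/-- The convolution `g ∗ φ_j` in the space variable. -/
def lpBlock (N : ℝ) (ϕ : EuclideanSpace ℝ (Fin d) → ℝ) (j : ℕ)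
    (g : EuclideanSpace ℝ (Fin d) → ℝ) (x : EuclideanSpace ℝ (Fin d)) : ℂ :=
  ∫ y, (g y : ℂ) * lpKernel N ϕ j (x - y)

/-- The generalized Besov norm on `H_T`,
`|g|_{β,∞} = sup_j w(N^{-j})^{-β} sup_{(t,x) ∈ H_T} |(g(t,·) ∗ φ_j)(x)|`, with values in `[0,∞]`. -/
def besovNorm (w : ℝ → ℝ) (N : ℝ) (ϕ : EuclideanSpace ℝ (Fin d) → ℝ) (β T : ℝ)
    (g : ℝ → EuclideanSpace ℝ (Fin d) → ℝ) : ℝ≥0∞ :=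
  ⨆ j : ℕ, ENNReal.ofReal (w (N ^ (-(j : ℤ))) ^ (-β)) *
    ⨆ t ∈ Icc (0 : ℝ) T, ⨆ x : EuclideanSpace ℝ (Fin d), ‖lpBlock N ϕ j (g t) x‖ₑ

/-- `u` solves `∂_t u = L^ν u - λ u + f` on `H_T` with `u(0,·) = 0`; the time derivative is
one-sided at `t = 0` and `t = T`. -/
structure IsSolution (ν : Measure (EuclideanSpace ℝ (Fin d))) (lam T : ℝ)
    (f u : ℝ → EuclideanSpace ℝ (Fin d) → ℝ) : Prop where
  hasDeriv : ∀ t ∈ Icc (0 : ℝ) T, ∀ x,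
    HasDerivWithinAt (fun s => u s x) (levyOp ν (u t) x - lam * u t x + f t x) (Icc 0 T) t
  initial : ∀ x, u 0 x = 0

end Spaces

end LevyCauchy

end

open LevyCauchy

/-!
# The Cauchy problem for a Lévy operator with smooth data

The solution is Duhamel's integral for the transition semigroup `S_r g(x) = 𝐄 g(x + Z_r)`. What
the argument uses of the process is the weak continuity of its laws and the forward equation
`S_r g = g + ∫_0^r S_q (L^ν g) dq`, for smooth `g` with bounded derivatives
(`HasLevyLaws.continuous`, `HasLevyLaws.forward`).

Both depend only on the characteristic functions of the laws of `Z`. The exponential formula for Poisson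
random measures (`poissonRandomMeasure_integral_exp`) computes the characteristic function of the
process with its small jumps removed; letting the truncation tend to zero gives the Lévy–Khintchine
formula `𝐄 e^{i ⟨Z_t, ξ⟩} = e^{t ψ(ξ)}` (`charFun_levyProcess`). Now `L^ν` acts on the character
`x ↦ e^{i ⟨x, ξ⟩}` as multiplication by `ψ(ξ)`, so that the forward equation for characters is
`e^{r ψ} = 1 + ∫_0^r e^{q ψ} ψ dq`. By Fourier inversion it passes to test functions
(`HasLevyLaws.forward_of_hasCompactSupport`), and by smooth cutoffs and dominated convergence to
smooth functions with bounded derivatives. In the integrals over `ν` the dominating function is a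
multiple of `levyEnvelope`, which is `ν`-integrable because `χ_α` compensates exactly the part of
the jumps that the order `α` does not control.

The semigroup acts by integrals over translates, hence it preserves joint continuity and boundedness
of the derivatives in `x` (`IsSmoothFamily.semigroup`) and commutes with `L^ν`. Differentiating
Duhamel's integral under the integral sign therefore gives a smooth solution (`isCbInf_duhamel`,
`hasDerivWithinAt_duhamel`). Conversely, if `v` is a solution, then `s ↦ e^{-λ(t-s)} S_{t-s} v_s`
has derivative `e^{-λ(t-s)} S_{t-s} f_s`; integrating over `[0, t]` shows that `v` is Duhamel's
integral (`eq_duhamel_of_hasDerivAt`).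
-/

noncomputable section

/-! ### Poisson random measures -/

/-- The mean of the Poisson distribution. -/
lemma lintegral_natCast_poissonMeasure (r : ℝ≥0) :
    ∫⁻ n : ℕ, (n : ℝ≥0∞) ∂(poissonMeasure r) = r := by
  have h1 : ∑' n : ℕ, poissonMeasure r {n} = 1 := by
    have := lintegral_countable' (μ := poissonMeasure r) fun _ => 1
    simpa using this.symm
  rw [lintegral_countable', tsum_eq_zero_add' ENNReal.summable]
  have h2 : ∀ n : ℕ, ((n + 1 : ℕ) : ℝ≥0∞) * poissonMeasure r {n + 1}
      = poissonMeasure r {n} * r := by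
    intro n
    rw [poissonMeasure_singleton, poissonMeasure_singleton, ← ENNReal.ofReal_natCast,
      ← ENNReal.ofReal_mul (by positivity), ← ENNReal.ofReal_coe_nnreal,
      ← ENNReal.ofReal_mul (by positivity)]
    congr 1
    rw [Nat.factorial_succ]
    push_cast
    field_simp
    ring
  simp_rw [h2]
  rw [ENNReal.tsum_mul_right, h1]
  simp

section Poisson

variable {Ω X : Type*} [MeasurableSpace Ω] [MeasurableSpace X] {P : Measure Ω}
  {m : Measure X} {J : Ω → Measure X}

/-- The mean number of points in `B` is its intensity. -/
lemma poissonRandomMeasure_lintegral_apply (hJ : IsPoissonRandomMeasure P m J) {B : Set X}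
    (hB : MeasurableSet B) (hm : m B < ∞) : ∫⁻ ω, J ω B ∂P = m B := by
  have hmeas : Measurable fun ω => J ω B := (Measure.measurable_coe hB).comp hJ.measurable
  have : ∫⁻ ω, J ω B ∂P = ∫⁻ x, x ∂(P.map fun ω => J ω B) := by
    exact (lintegral_map measurable_id hmeas).symm
  rw [this, hJ.map_eq B hB hm, lintegral_map' aemeasurable_id' .of_discrete]
  simp only [lintegral_natCast_poissonMeasure]
  exact ENNReal.coe_toNNReal hm.ne

/-- The mean measure of a Poisson random measure is its intensity. -/
lemma poissonRandomMeasure_bind [SigmaFinite m] (hJ : IsPoissonRandomMeasure P m J) :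
    P.bind J = m := by
  rw [Measure.ext_iff_of_iUnion_eq_univ (iUnion_spanningSets m)]
  intro i
  ext B hB
  have hS := measurableSet_spanningSets m i
  rw [Measure.restrict_apply hB, Measure.restrict_apply hB,
    Measure.bind_apply (hB.inter hS) hJ.measurable.aemeasurable]
  exact poissonRandomMeasure_lintegral_apply hJ (hB.inter hS)
    ((measure_mono inter_subset_right).trans_lt (measure_spanningSets_lt_top m i))

/-- **Campbell's formula** for nonnegative functions. -/
lemma poissonRandomMeasure_lintegral_lintegral [SigmaFinite m]
    (hJ : IsPoissonRandomMeasure P m J) {g : X → ℝ≥0∞} (hg : Measurable g) :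
    ∫⁻ ω, ∫⁻ x, g x ∂(J ω) ∂P = ∫⁻ x, g x ∂m := by
  rw [← Measure.lintegral_bind hJ.measurable.aemeasurable hg.aemeasurable,
    poissonRandomMeasure_bind hJ]

/-- A set contains either no point or at least one, since the number of points is an integer. -/
lemma poissonRandomMeasure_ae_zero_or_one_le (hJ : IsPoissonRandomMeasure P m J) {B : Set X}
    (hB : MeasurableSet B) (hm : m B < ∞) : ∀ᵐ ω ∂P, J ω B = 0 ∨ 1 ≤ J ω B := by
  have hmeas : Measurable fun ω => J ω B := (Measure.measurable_coe hB).comp hJ.measurable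
  have hs : MeasurableSet {x : ℝ≥0∞ | x = 0 ∨ 1 ≤ x} :=
    (measurableSet_singleton (0 : ℝ≥0∞)).union measurableSet_Ici
  have : ∀ᵐ x ∂(P.map fun ω => J ω B), x ∈ {x : ℝ≥0∞ | x = 0 ∨ 1 ≤ x} := by
    rw [hJ.map_eq B hB hm]
    refine (ae_map_iff .of_discrete hs).2 ?_
    refine ae_of_all _ fun n => ?_
    rcases Nat.eq_zero_or_pos n with h | h
    · left; simp [h]
    · right; exact_mod_cast h
  exact (ae_map_iff hmeas.aemeasurable hs).1 this

/-- If `∫ min(1, |h|) dm < ∞` then `h` is integrable against almost every realization: the points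
where `|h| ≤ 1` are controlled by Campbell's formula, there are finitely many points where
`|h| > 1`, and `h` is bounded on them. -/
lemma poissonRandomMeasure_ae_integrable [SigmaFinite m]
    (hJ : IsPoissonRandomMeasure P m J) {V : Type*} [NormedAddCommGroup V] [MeasurableSpace V]
    [OpensMeasurableSpace V] [SecondCountableTopology V] {h : X → V} (hh : Measurable h)
    (hint : ∫⁻ x, min 1 ‖h x‖ₑ ∂m ≠ ∞) : ∀ᵐ ω ∂P, Integrable h (J ω) := by
  have hmin : Measurable fun x => min 1 ‖h x‖ₑ := measurable_const.min hh.enorm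
  have h1 : ∀ᵐ ω ∂P, ∫⁻ x, min 1 ‖h x‖ₑ ∂(J ω) < ∞ := by
    refine ae_lt_top ?_ ?_
    · exact (Measure.measurable_lintegral hmin).comp hJ.measurable
    · rwa [poissonRandomMeasure_lintegral_lintegral hJ hmin]
  -- By Markov's inequality the sets where `h` is large contain a point with small probability, so
  -- that almost surely one of them contains none.
  let B : ℕ → Set X := fun n => {x | ((n : ℝ≥0∞) + 1) ≤ ‖h x‖ₑ}
  have hB : ∀ n, MeasurableSet (B n) := fun n => measurableSet_le measurable_const hh.enorm
  have hBm0 : m (B 0) < ∞ := by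
    refine lt_of_le_of_lt ?_ hint.lt_top
    have := mul_meas_ge_le_lintegral (μ := m) hmin 1
    rw [one_mul] at this
    refine le_trans (measure_mono ?_) this
    intro x hx
    simp only [B, mem_ofPred_eq, Nat.cast_zero, zero_add] at hx
    simpa using hx
  have hanti : Antitone B := by
    intro a b hab x hx
    simp only [B, mem_ofPred_eq] at hx ⊢
    refine le_trans ?_ hx
    gcongr
  have hlim : Tendsto (fun n => m (B n)) atTop (𝓝 0) := by
    have := tendsto_measure_iInter_atTop (μ := m) (s := B)
      (fun i => (hB i).nullMeasurableSet) hanti ⟨0, hBm0.ne⟩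
    have he : ⋂ n, B n = ∅ := by
      refine eq_empty_of_forall_notMem fun x hx => ?_
      rw [mem_iInter] at hx
      obtain ⟨n, hn⟩ := ENNReal.exists_nat_gt (enorm_ne_top (x := h x))
      have := hx n
      simp only [B, mem_ofPred_eq] at this
      exact absurd (le_self_add.trans this) (not_le.2 hn)
    rwa [he, measure_empty] at this
  have hmB : ∀ n, m (B n) < ∞ := fun n => (measure_mono (hanti (Nat.zero_le n))).trans_lt hBm0
  have h2 : ∀ᵐ ω ∂P, ∃ n, J ω (B n) = 0 := by
    have hsub : ∀ n, P {ω | ∀ k, J ω (B k) ≠ 0} ≤ m (B n) := by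
      intro n
      rw [← poissonRandomMeasure_lintegral_apply hJ (hB n) (hmB n)]
      have h3 := mul_meas_ge_le_lintegral (μ := P)
        ((Measure.measurable_coe (hB n)).comp hJ.measurable) 1
      rw [one_mul] at h3
      refine le_trans (measure_mono_ae ?_) h3
      filter_upwards [poissonRandomMeasure_ae_zero_or_one_le hJ (hB n) (hmB n)] with ω hω hk
      exact hω.resolve_left (hk n)
    have h0 : P {ω | ∀ k, J ω (B k) ≠ 0} = 0 :=
      le_antisymm (ge_of_tendsto' hlim hsub) (zero_le)
    rw [ae_iff]
    simpa using h0
  filter_upwards [h1, h2] with ω hω1 ⟨n, hn⟩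
  refine ⟨hh.aestronglyMeasurable, ?_⟩
  have hle : ∀ᵐ x ∂(J ω), ‖h x‖ₑ ≤ ((n : ℝ≥0∞) + 1) * min 1 ‖h x‖ₑ := by
    have : ∀ᵐ x ∂(J ω), x ∉ B n := by
      rw [ae_iff]; simpa using hn
    filter_upwards [this] with x hx
    simp only [B, mem_ofPred_eq, not_le] at hx
    rcases le_total 1 ‖h x‖ₑ with h' | h'
    · rw [min_eq_left h', mul_one]; exact hx.le
    · rw [min_eq_right h']
      exact le_mul_of_one_le_left (zero_le) le_add_self
  refine lt_of_le_of_lt (lintegral_mono_ae hle) ?_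
  rw [lintegral_const_mul _ hmin]
  exact ENNReal.mul_lt_top (by finiteness) hω1

/-- The integral is measurable because it is the difference of the integrals of the positive and the
negative part. -/
lemma poissonRandomMeasure_aemeasurable_integral
    (hJ : IsPoissonRandomMeasure P m J) {h : X → ℝ} (hh : Measurable h)
    (hint : ∀ᵐ ω ∂P, Integrable h (J ω)) : AEMeasurable (fun ω => ∫ x, h x ∂(J ω)) P := by
  have h1 : Measurable fun ω => (∫⁻ x, ENNReal.ofReal (h x) ∂(J ω)).toReal
      - (∫⁻ x, ENNReal.ofReal (-h x) ∂(J ω)).toReal :=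
    (((Measure.measurable_lintegral hh.ennreal_ofReal).comp hJ.measurable).ennreal_toReal).sub
    (((Measure.measurable_lintegral hh.neg.ennreal_ofReal).comp hJ.measurable).ennreal_toReal)
  refine ⟨_, h1, ?_⟩
  filter_upwards [hint] with ω hω
  exact integral_eq_lintegral_pos_part_sub_lintegral_neg_part hω

/-- The characteristic function of `c` times a Poisson variable, at `1`. If `c = 0` then `B` may have
infinite intensity. -/
lemma poissonRandomMeasure_charFun_smul [IsProbabilityMeasure P]
    (hJ : IsPoissonRandomMeasure P m J) {B : Set X} (hB : MeasurableSet B) (c : ℝ)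
    (hm : c ≠ 0 → m B < ∞) :
    charFun (P.map fun ω => (J ω).real B * c) 1
      = Complex.exp (m.real B * (Complex.exp (c * Complex.I) - 1)) := by
  have hmeas : Measurable fun ω => J ω B := (Measure.measurable_coe hB).comp hJ.measurable
  by_cases hc : c = 0
  · subst hc
    have : P.map (fun _ : Ω => (0 : ℝ)) = Measure.dirac 0 := by
      rw [Measure.map_const]; simp
    simp [this, charFun_dirac]
  have h1 : P.map (fun ω => (J ω).real B) = (poissonMeasure (m B).toNNReal).map (Nat.cast) := by
    have : (fun ω => (J ω).real B) = ENNReal.toReal ∘ fun ω => J ω B := rfl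
    rw [this, ← Measure.map_map ENNReal.measurable_toReal hmeas, hJ.map_eq B hB (hm hc),
      Measure.map_map ENNReal.measurable_toReal (by fun_prop)]
    congr 1
  have h2 : (fun ω => (J ω).real B * c) = (fun x => c * x) ∘ fun ω => (J ω).real B := by
    ext ω; simp [mul_comm]
  have h3 : Measurable fun ω => (J ω).real B := hmeas.ennreal_toReal
  rw [h2, ← Measure.map_map (by fun_prop) h3, charFun_map_mul, h1, charFun_map_cast_poissonMeasure]
  simp [Measure.real, ENNReal.coe_toNNReal_eq_toReal]

/-- The exponential formula for simple functions. -/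
lemma poissonRandomMeasure_integral_exp_simpleFunc [IsProbabilityMeasure P] [SigmaFinite m]
    (hJ : IsPoissonRandomMeasure P m J) (s : SimpleFunc X ℝ) (hs : Integrable s m) :
    ∫ ω, Complex.exp ((∫ x, s x ∂(J ω) : ℝ) * Complex.I) ∂P
      = Complex.exp (∫ x, (Complex.exp (s x * Complex.I) - 1) ∂m) := by
  have hfin : ∀ c ≠ 0, m (s ⁻¹' {c}) < ∞ := SimpleFunc.integrable_iff.1 hs
  have hJs : ∀ᵐ ω ∂P, Integrable s (J ω) := by
    refine poissonRandomMeasure_ae_integrable hJ s.measurable ?_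
    exact (lt_of_le_of_lt (lintegral_mono fun x => min_le_right _ _) hs.2).ne
  let e := Fintype.equivFin s.range
  let c : Fin (Fintype.card s.range) → ℝ := fun i => (e.symm i : ℝ)
  let B : Fin (Fintype.card s.range) → Set X := fun i => s ⁻¹' {c i}
  have hB : ∀ i, MeasurableSet (B i) := fun i => s.measurableSet_fiber _
  have hsum : ∀ {W : Type} [AddCommMonoid W] (g : ℝ → W),
      ∑ x ∈ s.range, g x = ∑ i, g (c i) := by
    intro W _ g
    rw [← Finset.sum_coe_sort s.range g]
    exact Fintype.sum_equiv e _ _ (fun x => by simp [c])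
  have hd : Pairwise fun i j => Disjoint (B i) (B j) := by
    intro i j hij
    refine Disjoint.preimage _ ?_
    rw [Set.disjoint_singleton]
    intro h
    exact hij (e.symm.injective (Subtype.ext h))
  -- The fibres of `s` are disjoint, so that their counts are independent.
  have hind := hJ.indep _ B hB hd
  have hind2 : iIndepFun (fun i ω => (J ω).real (B i) * c i) P := by
    have := hind.comp (fun i (x : ℝ≥0∞) => x.toReal * c i)
      (fun i => ENNReal.measurable_toReal.mul_const _)
    exact this
  have hmX : ∀ i, Measurable fun ω => (J ω).real (B i) * c i := fun i =>
    (((Measure.measurable_coe (hB i)).comp hJ.measurable).ennreal_toReal).mul_const _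
  have hchar := congrFun (iIndepFun.charFun_map_fun_sum_eq_prod
    (fun i => (hmX i).aemeasurable) hind2) 1
  have hl : ∫ ω, Complex.exp ((∫ x, s x ∂(J ω) : ℝ) * Complex.I) ∂P
      = charFun (P.map fun ω => ∑ i, (J ω).real (B i) * c i) 1 := by
    rw [charFun_apply_real, integral_map (Finset.measurable_sum _ fun i _ => hmX i).aemeasurable
      (by fun_prop)]
    refine integral_congr_ae ?_
    filter_upwards [hJs] with ω hω
    have : ∫ x, s x ∂(J ω) = ∑ i, (J ω).real (B i) * c i := by
      rw [SimpleFunc.integral_eq_sum s hω, hsum]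
      simp [B]
    rw [this]
    simp
  have hr : ∫ x, (Complex.exp (s x * Complex.I) - 1) ∂m
      = ∑ i, (m.real (B i) : ℂ) * (Complex.exp (c i * Complex.I) - 1) := by
    let g : ℝ → ℂ := fun y => Complex.exp (y * Complex.I) - 1
    have hg : g 0 = 0 := by simp [g]
    have h1 := SimpleFunc.map_integral s g hs hg
    have h2 := SimpleFunc.integral_eq_integral (s.map g)
      ((SimpleFunc.integrable_iff.2 fun y hy => by
        exact (SimpleFunc.FinMeasSupp.map (SimpleFunc.integrable_iff_finMeasSupp.1 hs) hg
          ).meas_preimage_singleton_ne_zero hy) : Integrable (s.map g) m)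
    rw [h1, hsum] at h2
    simpa [g, B] using h2.symm
  rw [hl, hchar, hr, Complex.exp_sum, Finset.prod_apply]
  refine Finset.prod_congr rfl fun i _ => ?_
  exact poissonRandomMeasure_charFun_smul hJ (hB i) (c i) (hfin _)

/-- The **exponential formula**: the characteristic function of the integral of `h` against a
Poisson random measure. -/
lemma poissonRandomMeasure_integral_exp [IsProbabilityMeasure P] [SigmaFinite m]
    (hJ : IsPoissonRandomMeasure P m J) {h : X → ℝ} (hh : Measurable h)
    (hint : ∫⁻ x, min 1 ‖h x‖ₑ ∂m ≠ ∞) :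
    ∫ ω, Complex.exp ((∫ x, h x ∂(J ω) : ℝ) * Complex.I) ∂P
      = Complex.exp (∫ x, (Complex.exp (h x * Complex.I) - 1) ∂m) := by
  let s : ℕ → SimpleFunc X ℝ := fun n => SimpleFunc.approxOn h hh univ 0 (mem_univ _) n
  have hs_le : ∀ n x, ‖s n x‖ ≤ 2 * ‖h x‖ := by
    intro n x
    have := SimpleFunc.norm_approxOn_zero_le hh (mem_univ (0 : ℝ)) x n
    linarith
  have hs_lim : ∀ x, Tendsto (fun n => s n x) atTop (𝓝 (h x)) := fun x =>
    SimpleFunc.tendsto_approxOn hh _ (by simp)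
  have hs_le' : ∀ n x, min 1 ‖s n x‖ₑ ≤ 2 * min 1 ‖h x‖ₑ := by
    intro n x
    have h1 : ‖s n x‖ₑ ≤ 2 * ‖h x‖ₑ := by
      have := ENNReal.ofReal_le_ofReal (hs_le n x)
      rwa [ENNReal.ofReal_mul (by norm_num), ofReal_norm, ofReal_norm,
        ENNReal.ofReal_ofNat] at this
    rcases le_total 1 ‖h x‖ₑ with h' | h'
    · rw [min_eq_left h']
      exact (min_le_left _ _).trans (by norm_num)
    · rw [min_eq_right h']
      exact (min_le_right _ _).trans h1
  have hs_int : ∀ n, Integrable (s n) m := by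
    intro n
    rw [SimpleFunc.integrable_iff]
    intro y hy
    have hpos : min 1 ‖y‖ₑ ≠ 0 := by simp [hy]
    have h1 : ∫⁻ x, min 1 ‖s n x‖ₑ ∂m ≠ ∞ := by
      refine (lt_of_le_of_lt (lintegral_mono (hs_le' n)) ?_).ne
      rw [lintegral_const_mul _ (measurable_const.min hh.enorm)]
      exact ENNReal.mul_lt_top (by finiteness) hint.lt_top
    have h2 := mul_meas_ge_le_lintegral (μ := m)
      (measurable_const.min (s n).measurable.enorm : Measurable fun x => min 1 ‖s n x‖ₑ)
      (min 1 ‖y‖ₑ)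
    have h3 : m {x | min 1 ‖y‖ₑ ≤ min 1 ‖s n x‖ₑ} < ∞ := by
      by_contra hcon
      rw [not_lt, top_le_iff] at hcon
      rw [hcon, ENNReal.mul_top hpos] at h2
      exact h1 (top_le_iff.1 h2)
    refine (measure_mono ?_).trans_lt h3
    intro x hx
    have : s n x = y := hx
    simp [this]
  -- This bound makes `min 1 |h|` a dominating function for the exponents.
  have hexp_le : ∀ y : ℝ, ‖Complex.exp (y * Complex.I) - 1‖ₑ ≤ 2 * min 1 ‖y‖ₑ := by
    intro y
    have h1 : ‖Complex.exp (y * Complex.I) - 1‖ ≤ ‖y‖ := by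
      rw [mul_comm]; exact Real.norm_exp_I_mul_ofReal_sub_one_le
    have h2 : ‖Complex.exp (y * Complex.I) - 1‖ ≤ 2 := by
      refine (norm_sub_le _ _).trans ?_
      rw [Complex.norm_exp_ofReal_mul_I]; norm_num
    rcases le_total 1 ‖y‖ₑ with h' | h'
    · rw [min_eq_left h', ← ofReal_norm]
      refine (ENNReal.ofReal_le_ofReal h2).trans ?_
      simp
    · rw [min_eq_right h', ← ofReal_norm, ← ofReal_norm]
      refine (ENNReal.ofReal_le_ofReal h1).trans ?_
      exact le_mul_of_one_le_left (zero_le) (by norm_num)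
  have hr : Tendsto (fun n => Complex.exp (∫ x, (Complex.exp (s n x * Complex.I) - 1) ∂m)) atTop
      (𝓝 (Complex.exp (∫ x, (Complex.exp (h x * Complex.I) - 1) ∂m))) := by
    refine (Complex.continuous_exp.tendsto _).comp ?_
    refine tendsto_integral_of_dominated_convergence
      (fun x => (2 * (2 * min 1 ‖h x‖ₑ)).toReal) ?_ ?_ ?_ ?_
    · intro n
      have := (s n).measurable
      exact (by fun_prop : Measurable fun x =>
        Complex.exp (s n x * Complex.I) - 1).aestronglyMeasurable
    · refine integrable_toReal_of_lintegral_ne_top ?_ ?_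
      · exact ((measurable_const.min hh.enorm).const_mul _ |>.const_mul _).aemeasurable
      · rw [lintegral_const_mul _ ((measurable_const.min hh.enorm).const_mul _),
          lintegral_const_mul _ (measurable_const.min hh.enorm)]
        finiteness
    · intro n
      refine ae_of_all _ fun x => ?_
      rw [← toReal_enorm]
      refine ENNReal.toReal_mono ?_ ((hexp_le _).trans (by gcongr; exact hs_le' n x))
      have : min 1 ‖h x‖ₑ ≠ ∞ := (lt_of_le_of_lt (min_le_left _ _) ENNReal.one_lt_top).ne
      finiteness
    · refine ae_of_all _ fun x => ?_
      have : Continuous fun y : ℝ => Complex.exp (y * Complex.I) - 1 := by fun_prop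
      exact (this.tendsto _).comp (hs_lim x)
  have hl : Tendsto (fun n => ∫ ω, Complex.exp ((∫ x, s n x ∂(J ω) : ℝ) * Complex.I) ∂P) atTop
      (𝓝 (∫ ω, Complex.exp ((∫ x, h x ∂(J ω) : ℝ) * Complex.I) ∂P)) := by
    refine tendsto_integral_of_dominated_convergence (fun _ => 1) ?_ (integrable_const _) ?_ ?_
    · intro n
      have h3 := poissonRandomMeasure_aemeasurable_integral hJ (s n).measurable
        (poissonRandomMeasure_ae_integrable hJ (s n).measurable
          ((lt_of_le_of_lt (lintegral_mono fun x => min_le_right _ _) (hs_int n).2).ne))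
      exact (by fun_prop : AEMeasurable _ P).aestronglyMeasurable
    · intro n
      exact ae_of_all _ fun ω => by rw [Complex.norm_exp_ofReal_mul_I]
    · filter_upwards [poissonRandomMeasure_ae_integrable hJ hh hint] with ω hω
      have : Continuous fun y : ℝ => Complex.exp (y * Complex.I) := by fun_prop
      refine (this.tendsto _).comp ?_
      refine tendsto_integral_of_dominated_convergence (fun x => 2 * ‖h x‖)
        (fun n => (s n).aestronglyMeasurable) (hω.norm.const_mul 2)
        (fun n => ae_of_all _ (hs_le n)) (ae_of_all _ hs_lim)
  refine tendsto_nhds_unique hl (hr.congr fun n => ?_)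
  exact (poissonRandomMeasure_integral_exp_simpleFunc hJ (s n) (hs_int n)).symm

end Poisson

/-! ### A dominating function and the Lévy–Khintchine exponent -/

section Envelope

variable {d : ℕ}

/-- A function, integrable with respect to a Lévy measure of order `α`, that dominates the
integrand of the Lévy operator of order `α`: of size `|y|` or `|y|²` near the origin and `1` or
`|y|` far from it. -/
def levyEnvelope (α : ℝ) (y : EuclideanSpace ℝ (Fin d)) : ℝ :=
  if ‖y‖ ≤ 1 then (if α < 1 then ‖y‖ else ‖y‖ ^ 2) else (if 1 < α then ‖y‖ else 1)

lemma levyEnvelope_nonneg (α : ℝ) (y : EuclideanSpace ℝ (Fin d)) : 0 ≤ levyEnvelope α y := by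
  unfold levyEnvelope
  split_ifs <;> positivity

@[fun_prop]
lemma measurable_levyEnvelope (α : ℝ) :
    Measurable (levyEnvelope α : EuclideanSpace ℝ (Fin d) → ℝ) := by
  unfold levyEnvelope
  refine Measurable.ite (measurableSet_le measurable_norm measurable_const) ?_ ?_
  · split_ifs <;> fun_prop
  · split_ifs <;> fun_prop

@[fun_prop]
lemma measurable_chi (α : ℝ) : Measurable (chi α : EuclideanSpace ℝ (Fin d) → ℝ) := by
  unfold chi
  refine measurable_const.add (Measurable.ite ?_ measurable_const measurable_const)
  by_cases h : α = 1
  · simpa [h] using measurableSet_le (measurable_norm (α := EuclideanSpace ℝ (Fin d)))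
      (measurable_const (a := (1 : ℝ)))
  · simp [h]

lemma chi_of_lt {α : ℝ} (h : α < 1) (y : EuclideanSpace ℝ (Fin d)) : chi α y = 0 := by
  simp [chi, h.ne, h.not_gt]

lemma chi_of_gt {α : ℝ} (h : 1 < α) (h2 : α < 2) (y : EuclideanSpace ℝ (Fin d)) :
    chi α y = 1 := by
  simp [chi, h, h.ne', h2]

lemma chi_one (y : EuclideanSpace ℝ (Fin d)) : chi 1 y = if ‖y‖ ≤ 1 then 1 else 0 := by
  simp [chi]

lemma chi_nonneg (α : ℝ) (y : EuclideanSpace ℝ (Fin d)) : 0 ≤ chi α y := by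
  unfold chi
  split_ifs <;> norm_num

lemma chi_le_one (α : ℝ) (y : EuclideanSpace ℝ (Fin d)) : chi α y ≤ 1 := by
  unfold chi
  by_cases h : α ∈ Ioo (1 : ℝ) 2
  · simp [h, h.1.ne']
  · rw [if_neg h]
    split_ifs <;> norm_num

/-- The envelope dominates a difference corrected by a linear term. -/
lemma norm_sub_chi_smul_le {V : Type*} [NormedAddCommGroup V] [NormedSpace ℝ V] {α : ℝ}
    (hα : α ∈ Ioo (0 : ℝ) 2) (y : EuclideanSpace ℝ (Fin d)) {a b : V} {C : ℝ}
    (h0 : ‖a‖ ≤ C) (h1 : ‖a‖ ≤ C * ‖y‖) (h2 : ‖b‖ ≤ C * ‖y‖) (h3 : ‖a - b‖ ≤ C * ‖y‖ ^ 2) :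
    ‖a - chi α y • b‖ ≤ 2 * C * levyEnvelope α y := by
  have hC : 0 ≤ C := (norm_nonneg _).trans h0
  have hy := norm_nonneg y
  unfold levyEnvelope
  rcases lt_trichotomy α 1 with h | h | h
  · rw [chi_of_lt h, zero_smul, sub_zero]
    split_ifs <;> nlinarith
  · subst h
    rw [chi_one]
    by_cases hy1 : ‖y‖ ≤ 1
    · simp only [hy1, if_true, one_smul, lt_irrefl, if_false]
      nlinarith [mul_nonneg hC (sq_nonneg ‖y‖)]
    · simp only [hy1, if_false, zero_smul, sub_zero, lt_irrefl]
      linarith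
  · rw [chi_of_gt h hα.2, one_smul]
    by_cases hy1 : ‖y‖ ≤ 1
    · simp only [hy1, if_true, h.not_gt, if_false]
      nlinarith [mul_nonneg hC (sq_nonneg ‖y‖)]
    · simp only [hy1, if_false, h, if_true]
      have := norm_sub_le a b
      linarith

variable {ν : Measure (EuclideanSpace ℝ (Fin d))}

/-- If `α < 1`, then `|y|` is dominated near the origin by `|y|^σ` for some `σ < 1` with
`∫_{|y| ≤ 1} |y|^σ ν(dy) < ∞`, which exists by the definition of the order. The other cases are
immediate. -/
lemma integrable_levyEnvelope (hν : IsLevyMeasure ν) (hα : levyOrder ν ∈ Ioo (0 : ℝ) 2)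
    (hν_large : 1 < levyOrder ν →
      ∫⁻ y in {y : EuclideanSpace ℝ (Fin d) | 1 < ‖y‖}, ENNReal.ofReal ‖y‖ ∂ν < ∞) :
    Integrable (levyEnvelope (levyOrder ν)) ν := by
  refine ⟨(measurable_levyEnvelope _).aestronglyMeasurable, ?_⟩
  rw [hasFiniteIntegral_iff_ofReal (ae_of_all _ (levyEnvelope_nonneg _))]
  have hA : MeasurableSet {y : EuclideanSpace ℝ (Fin d) | ‖y‖ ≤ 1} :=
    measurableSet_le measurable_norm measurable_const
  have hAc : {y : EuclideanSpace ℝ (Fin d) | ‖y‖ ≤ 1}ᶜ = {y | 1 < ‖y‖} := by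
    ext y; simp
  rw [← lintegral_add_compl _ hA, ENNReal.add_lt_top, hAc]
  constructor
  · by_cases h : levyOrder ν < 1
    · have hne : {σ : ℝ | σ ∈ Ioo (0 : ℝ) 2 ∧ ∫⁻ y in {y : EuclideanSpace ℝ (Fin d) | ‖y‖ ≤ 1},
          ENNReal.ofReal (‖y‖ ^ σ) ∂ν < ∞}.Nonempty := by
        -- The infimum of the empty set is `0`, which the positivity of the order excludes.
        by_contra hcon
        rw [not_nonempty_iff_eq_empty] at hcon
        have : levyOrder ν = 0 := by unfold levyOrder; rw [hcon, Real.sInf_empty]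
        exact hα.1.ne' this
      obtain ⟨σ, ⟨⟨hσ0, -⟩, hσ⟩, hσ1⟩ := exists_lt_of_csInf_lt hne h
      refine lt_of_le_of_lt (setLIntegral_mono' hA fun y hy => ?_) hσ
      have hy1 : ‖y‖ ≤ 1 := hy
      refine ENNReal.ofReal_le_ofReal ?_
      simp only [levyEnvelope, hy1, h, if_true]
      rcases (norm_nonneg y).eq_or_lt with h0 | h0
      · rw [← h0, Real.zero_rpow hσ0.ne']
      · calc ‖y‖ = ‖y‖ ^ (1 : ℝ) := (Real.rpow_one _).symm
          _ ≤ ‖y‖ ^ σ := Real.rpow_le_rpow_of_exponent_ge h0 hy1 hσ1.le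
    · refine lt_of_le_of_lt (setLIntegral_mono' hA fun y hy => ?_)
        (lt_of_le_of_lt (setLIntegral_le_lintegral _ _) hν.lintegral_lt_top)
      have hy1 : ‖y‖ ≤ 1 := hy
      refine ENNReal.ofReal_le_ofReal ?_
      simp only [levyEnvelope, hy1, h, if_true, if_false]
      exact le_min (pow_le_one₀ (norm_nonneg y) hy1) le_rfl
  · have hB : MeasurableSet {y : EuclideanSpace ℝ (Fin d) | 1 < ‖y‖} :=
      measurableSet_lt measurable_const measurable_norm
    by_cases h : 1 < levyOrder ν
    · refine lt_of_le_of_lt (setLIntegral_mono' hB fun y hy => ?_) (hν_large h)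
      have hy1 : ¬ ‖y‖ ≤ 1 := not_le.2 hy
      simp [levyEnvelope, hy1, h]
    · refine lt_of_le_of_lt (setLIntegral_mono' hB fun y hy => ?_)
        (lt_of_le_of_lt (setLIntegral_le_lintegral _ _) hν.lintegral_lt_top)
      have hy1 : 1 < ‖y‖ := hy
      refine ENNReal.ofReal_le_ofReal ?_
      simp only [levyEnvelope, hy1.not_ge, h, if_false]
      exact le_min le_rfl (one_le_pow₀ hy1.le)

lemma levyMeasure_norm_gt_lt_top (hν : IsLevyMeasure ν) {ε : ℝ} (hε : 0 < ε) :
    ν {y | ε < ‖y‖} < ∞ := by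
  have hpos : 0 < min 1 (ε ^ 2) := lt_min one_pos (by positivity)
  have h := mul_meas_ge_le_lintegral (μ := ν) (f := fun y : EuclideanSpace ℝ (Fin d) =>
    ENNReal.ofReal (min 1 (‖y‖ ^ 2))) (by fun_prop) (ENNReal.ofReal (min 1 (ε ^ 2)))
  have h2 : ν {y | ENNReal.ofReal (min 1 (ε ^ 2)) ≤ ENNReal.ofReal (min 1 (‖y‖ ^ 2))} < ∞ := by
    by_contra hcon
    rw [not_lt, top_le_iff] at hcon
    rw [hcon, ENNReal.mul_top (ENNReal.ofReal_pos.2 hpos).ne'] at h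
    exact absurd (top_le_iff.1 h) hν.lintegral_lt_top.ne
  refine (measure_mono fun y hy => ?_).trans_lt h2
  have hy1 : ε < ‖y‖ := hy
  refine ENNReal.ofReal_le_ofReal ?_
  gcongr

lemma sigmaFinite_of_isLevyMeasure (hν : IsLevyMeasure ν) : SigmaFinite ν := by
  refine ⟨⟨⟨fun n => {0} ∪ {y | 1 / ((n : ℝ) + 1) < ‖y‖}, fun _ => trivial, fun n => ?_, ?_⟩⟩⟩
  · refine (measure_union_le _ _).trans_lt ?_
    rw [hν.zero, zero_add]
    exact levyMeasure_norm_gt_lt_top hν (by positivity)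
  · refine eq_univ_of_forall fun y => mem_iUnion.2 ?_
    by_cases hy : y = 0
    · exact ⟨0, Or.inl hy⟩
    · obtain ⟨n, hn⟩ := exists_nat_one_div_lt (norm_pos_iff.2 hy)
      exact ⟨n, Or.inr hn⟩

end Envelope

section CharFun

variable {d : ℕ} {ν : Measure (EuclideanSpace ℝ (Fin d))}

/-- The integrand of the Lévy–Khintchine exponent. -/
def levySymbolIntegrand (α : ℝ) (ξ y : EuclideanSpace ℝ (Fin d)) : ℂ :=
  Complex.exp ((inner ℝ y ξ : ℝ) * Complex.I) - 1 - chi α y • ((inner ℝ y ξ : ℝ) * Complex.I)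

/-- The Lévy–Khintchine exponent `ψ(ξ) = ∫ (e^{i y·ξ} - 1 - i χ_α(y) y·ξ) ν(dy)`. -/
def levySymbol (ν : Measure (EuclideanSpace ℝ (Fin d))) (ξ : EuclideanSpace ℝ (Fin d)) : ℂ :=
  ∫ y, levySymbolIntegrand (levyOrder ν) ξ y ∂ν

lemma measurable_levySymbolIntegrand (α : ℝ) :
    Measurable fun p : EuclideanSpace ℝ (Fin d) × EuclideanSpace ℝ (Fin d) =>
      levySymbolIntegrand α p.1 p.2 := by
  unfold levySymbolIntegrand
  fun_prop

lemma norm_exp_mul_I_sub_one_sub_le (x : ℝ) :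
    ‖Complex.exp (x * Complex.I) - 1 - x * Complex.I‖ ≤ 3 * x ^ 2 := by
  have hn : ‖(x : ℂ) * Complex.I‖ = |x| := by simp
  rcases le_total |x| 1 with h | h
  · have := Complex.norm_exp_sub_one_sub_id_le (x := x * Complex.I) (by rwa [hn])
    rw [hn, sq_abs] at this
    nlinarith [sq_nonneg x]
  · have h1 : ‖Complex.exp (x * Complex.I) - 1 - x * Complex.I‖ ≤ 1 + 1 + |x| := by
      refine (norm_sub_le _ _).trans (add_le_add ((norm_sub_le _ _).trans ?_) hn.le)
      rw [Complex.norm_exp_ofReal_mul_I, norm_one]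
    nlinarith [sq_abs x]

lemma norm_levySymbolIntegrand_le {α : ℝ} (hα : α ∈ Ioo (0 : ℝ) 2)
    (ξ y : EuclideanSpace ℝ (Fin d)) :
    ‖levySymbolIntegrand α ξ y‖ ≤ 6 * (1 + ‖ξ‖) ^ 2 * levyEnvelope α y := by
  have hin : |inner ℝ y ξ| ≤ ‖ξ‖ * ‖y‖ := by
    rw [mul_comm]; exact abs_real_inner_le_norm y ξ
  have hξ := norm_nonneg ξ
  have hy := norm_nonneg y
  have hC1 : 3 ≤ 3 * (1 + ‖ξ‖) ^ 2 := by nlinarith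
  have hC2 : ‖ξ‖ ≤ 3 * (1 + ‖ξ‖) ^ 2 := by nlinarith
  have hC3 : 3 * ‖ξ‖ ^ 2 ≤ 3 * (1 + ‖ξ‖) ^ 2 := by nlinarith
  have := norm_sub_chi_smul_le hα y (C := 3 * (1 + ‖ξ‖) ^ 2)
    (a := Complex.exp ((inner ℝ y ξ : ℝ) * Complex.I) - 1) (b := (inner ℝ y ξ : ℝ) * Complex.I)
    ?_ ?_ ?_ ?_
  · unfold levySymbolIntegrand
    convert this using 2
    ring
  · refine (norm_sub_le _ _).trans ?_
    rw [Complex.norm_exp_ofReal_mul_I, norm_one]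
    linarith
  · have h1 : ‖Complex.exp ((inner ℝ y ξ : ℝ) * Complex.I) - 1‖ ≤ ‖(inner ℝ y ξ : ℝ)‖ := by
      rw [mul_comm]; exact Real.norm_exp_I_mul_ofReal_sub_one_le
    refine h1.trans (hin.trans ?_)
    gcongr
  · rw [norm_mul, Complex.norm_I, mul_one, Complex.norm_real]
    refine hin.trans ?_
    gcongr
  · refine (norm_exp_mul_I_sub_one_sub_le _).trans ?_
    have : (inner ℝ y ξ : ℝ) ^ 2 ≤ (‖ξ‖ * ‖y‖) ^ 2 := sq_le_sq' (abs_le.1 hin).1 (abs_le.1 hin).2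
    calc 3 * (inner ℝ y ξ : ℝ) ^ 2 ≤ 3 * (‖ξ‖ * ‖y‖) ^ 2 := by gcongr
      _ = 3 * ‖ξ‖ ^ 2 * ‖y‖ ^ 2 := by ring
      _ ≤ _ := by gcongr

lemma integrable_levySymbolIntegrand (hα : levyOrder ν ∈ Ioo (0 : ℝ) 2)
    (hρ : Integrable (levyEnvelope (levyOrder ν)) ν) (ξ : EuclideanSpace ℝ (Fin d)) :
    Integrable (levySymbolIntegrand (levyOrder ν) ξ) ν := by
  refine (hρ.const_mul (6 * (1 + ‖ξ‖) ^ 2)).mono' ?_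
    (ae_of_all _ (norm_levySymbolIntegrand_le hα ξ))
  exact ((measurable_levySymbolIntegrand _).comp measurable_prodMk_left).aestronglyMeasurable

end CharFun

/-! ### The Lévy–Khintchine formula for the process -/

section LevyProcess

variable {d : ℕ} {Ω : Type*} [MeasurableSpace Ω] {P : Measure Ω}
  {ν : Measure (EuclideanSpace ℝ (Fin d))} {J : Ω → Measure (ℝ × EuclideanSpace ℝ (Fin d))}
  {Z : ℝ → Ω → EuclideanSpace ℝ (Fin d)}

/-- The region of time and space that holds the jumps up to time `t` larger than `ε`. -/
def jumpSet (d : ℕ) (t ε : ℝ) : Set (ℝ × EuclideanSpace ℝ (Fin d)) :=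
  Ioc (0 : ℝ) t ×ˢ {y : EuclideanSpace ℝ (Fin d) | ε < ‖y‖}

lemma measurableSet_norm_gt (ε : ℝ) :
    MeasurableSet {y : EuclideanSpace ℝ (Fin d) | ε < ‖y‖} :=
  measurableSet_lt measurable_const measurable_norm

lemma measurableSet_jumpSet (t ε : ℝ) : MeasurableSet (jumpSet d t ε) :=
  measurableSet_Ioc.prod (measurableSet_norm_gt ε)

lemma restrict_levyIntensity_prod [SFinite ν] (t : ℝ) (B : Set (EuclideanSpace ℝ (Fin d))) :
    (levyIntensity ν).restrict (Ioc (0 : ℝ) t ×ˢ B)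
      = (volume.restrict (Ioc (0 : ℝ) t)).prod (ν.restrict B) := by
  rw [levyIntensity, ← Measure.prod_restrict, Measure.restrict_restrict measurableSet_Ioc]
  congr 2
  ext x
  simp only [mem_inter_iff, mem_Ioc, mem_Ici]
  exact ⟨fun h => h.1, fun h => ⟨h, h.1.le⟩⟩

lemma setIntegral_levyIntensity_prod [SFinite ν] {V : Type*} [NormedAddCommGroup V]
    [NormedSpace ℝ V] {t : ℝ} (ht : 0 ≤ t) (B : Set (EuclideanSpace ℝ (Fin d)))
    (g : EuclideanSpace ℝ (Fin d) → V) :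
    ∫ p in Ioc (0 : ℝ) t ×ˢ B, g p.2 ∂(levyIntensity ν) = t • ∫ y in B, g y ∂ν := by
  rw [restrict_levyIntensity_prod, integral_fun_snd]
  simp [ht]

lemma setLIntegral_levyIntensity_prod [SFinite ν] (t : ℝ) (B : Set (EuclideanSpace ℝ (Fin d)))
    {g : EuclideanSpace ℝ (Fin d) → ℝ≥0∞} (hg : Measurable g) :
    ∫⁻ p in Ioc (0 : ℝ) t ×ˢ B, g p.2 ∂(levyIntensity ν)
      = ENNReal.ofReal t * ∫⁻ y in B, g y ∂ν := by
  rw [restrict_levyIntensity_prod, lintegral_prod _ (by fun_prop)]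
  simp [mul_comm]

lemma sigmaFinite_levyIntensity [SigmaFinite ν] : SigmaFinite (levyIntensity ν) := by
  unfold levyIntensity
  infer_instance

/-- The sum of all jumps up to time `t` that are larger than `ε`, with only the part `χ_α(y) y`
compensated. -/
def truncatedJumpSum (ν : Measure (EuclideanSpace ℝ (Fin d)))
    (J : Ω → Measure (ℝ × EuclideanSpace ℝ (Fin d))) (t ε : ℝ) (ω : Ω) :
    EuclideanSpace ℝ (Fin d) :=
  (∫ p in jumpSet d t ε, p.2 ∂(J ω))
    - t • ∫ y in {y : EuclideanSpace ℝ (Fin d) | ε < ‖y‖}, chi (levyOrder ν) y • y ∂ν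

/-- Almost surely, `g` is summable over the jumps up to time `t` with values in `B`. -/
lemma ae_integrableOn_jumps [SigmaFinite ν] (hJ : IsPoissonRandomMeasure P (levyIntensity ν) J)
    (t : ℝ) {B : Set (EuclideanSpace ℝ (Fin d))} (hB : MeasurableSet B)
    {g : EuclideanSpace ℝ (Fin d) → EuclideanSpace ℝ (Fin d)} (hg : Measurable g)
    (hint : ∫⁻ y in B, min 1 ‖g y‖ₑ ∂ν ≠ ∞) :
    ∀ᵐ ω ∂P, IntegrableOn (fun p : ℝ × EuclideanSpace ℝ (Fin d) => g p.2)
      (Ioc (0 : ℝ) t ×ˢ B) (J ω) := by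
  have := sigmaFinite_levyIntensity (ν := ν)
  have hS : MeasurableSet (Ioc (0 : ℝ) t ×ˢ B) := measurableSet_Ioc.prod hB
  have hg2 : Measurable fun p : ℝ × EuclideanSpace ℝ (Fin d) => g p.2 := hg.comp measurable_snd
  have := poissonRandomMeasure_ae_integrable hJ (hg2.indicator hS) ?_
  · filter_upwards [this] with ω hω
    exact (integrable_indicator_iff hS).1 hω
  · have h1 : ∀ p, min 1 ‖(Ioc (0 : ℝ) t ×ˢ B).indicator
        (fun p : ℝ × EuclideanSpace ℝ (Fin d) => g p.2) p‖ₑ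
        = (Ioc (0 : ℝ) t ×ˢ B).indicator (fun p => min 1 ‖g p.2‖ₑ) p := by
      intro p
      by_cases hp : p ∈ Ioc (0 : ℝ) t ×ˢ B
      · simp only [indicator_of_mem hp]
      · simp only [indicator_of_notMem hp]; simp
    simp_rw [h1]
    rw [lintegral_indicator hS,
      setLIntegral_levyIntensity_prod (g := fun y => min 1 ‖g y‖ₑ) t B
        (measurable_const.min hg.enorm)]
    finiteness

lemma ae_integrableOn_jumpSet (hν : IsLevyMeasure ν)
    (hJ : IsPoissonRandomMeasure P (levyIntensity ν) J) (t : ℝ) {ε : ℝ} (hε : 0 < ε) :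
    ∀ᵐ ω ∂P, IntegrableOn (fun p : ℝ × EuclideanSpace ℝ (Fin d) => p.2)
      (jumpSet d t ε) (J ω) := by
  have := sigmaFinite_of_isLevyMeasure hν
  refine ae_integrableOn_jumps hJ t (measurableSet_norm_gt ε) measurable_id ?_
  refine (lt_of_le_of_lt (lintegral_mono fun y => min_le_left _ _) ?_).ne
  simpa using levyMeasure_norm_gt_lt_top hν hε

lemma ae_integrableOn_largeJumps (hν : IsLevyMeasure ν) (hα : levyOrder ν ∈ Ioo (0 : ℝ) 2)
    (hρ : Integrable (levyEnvelope (levyOrder ν)) ν)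
    (hJ : IsPoissonRandomMeasure P (levyIntensity ν) J) (t : ℝ) :
    ∀ᵐ ω ∂P, IntegrableOn
      (fun p : ℝ × EuclideanSpace ℝ (Fin d) => (1 - chi (levyOrder ν) p.2) • p.2)
      (Ioc (0 : ℝ) t ×ˢ univ) (J ω) := by
  have := sigmaFinite_of_isLevyMeasure hν
  refine ae_integrableOn_jumps hJ t MeasurableSet.univ
    (g := fun y => (1 - chi (levyOrder ν) y) • y) (by fun_prop) ?_
  rw [Measure.restrict_univ]
  refine (lt_of_le_of_lt (lintegral_mono fun y => ?_) hρ.2).ne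
  rw [Real.enorm_of_nonneg (levyEnvelope_nonneg _ _), ← ofReal_norm, ← ENNReal.ofReal_one,
    ← ENNReal.ofReal_min]
  refine ENNReal.ofReal_le_ofReal ?_
  have hy := norm_nonneg y
  rcases lt_trichotomy (levyOrder ν) 1 with h | h | h
  · rw [chi_of_lt h, levyEnvelope]
    simp only [h, h.not_gt, if_true, if_false, sub_zero, one_smul]
    split_ifs
    · exact min_le_right _ _
    · exact min_le_left _ _
  · rw [h, chi_one, levyEnvelope]
    simp only [lt_irrefl, if_false]
    split_ifs
    · simp
    · exact min_le_left _ _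
  · rw [chi_of_gt h hα.2]
    simp [levyEnvelope_nonneg]

/-- The characteristic function of the compensated sum of the jumps larger than `ε`. The
measurability of the integrand is recorded for use with dominated convergence. -/
lemma integral_exp_truncatedJumpSum [IsProbabilityMeasure P] (hν : IsLevyMeasure ν)
    (hα : levyOrder ν ∈ Ioo (0 : ℝ) 2) (hρ : Integrable (levyEnvelope (levyOrder ν)) ν)
    (hJ : IsPoissonRandomMeasure P (levyIntensity ν) J) {t ε : ℝ} (ht : 0 ≤ t) (hε : 0 < ε)
    (ξ : EuclideanSpace ℝ (Fin d)) :
    AEStronglyMeasurable (fun ω => Complex.exp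
      ((inner ℝ (truncatedJumpSum ν J t ε ω) ξ : ℝ) * Complex.I)) P ∧
    ∫ ω, Complex.exp ((inner ℝ (truncatedJumpSum ν J t ε ω) ξ : ℝ) * Complex.I) ∂P
      = Complex.exp (t * ∫ y in {y | ε < ‖y‖}, levySymbolIntegrand (levyOrder ν) ξ y ∂ν) := by
  have := sigmaFinite_of_isLevyMeasure hν
  have := sigmaFinite_levyIntensity (ν := ν)
  have hS := measurableSet_jumpSet (d := d) t ε
  have hB := measurableSet_norm_gt (d := d) ε
  have hνB := levyMeasure_norm_gt_lt_top hν hε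
  let h : ℝ × EuclideanSpace ℝ (Fin d) → ℝ := (jumpSet d t ε).indicator fun p => inner ℝ p.2 ξ
  have hh : Measurable h := (by fun_prop : Measurable fun p : ℝ × EuclideanSpace ℝ (Fin d) =>
    (inner ℝ p.2 ξ : ℝ)).indicator hS
  have hhint : ∫⁻ x, min 1 ‖h x‖ₑ ∂(levyIntensity ν) ≠ ∞ := by
    have hm : levyIntensity ν (jumpSet d t ε) < ∞ := by
      have := setLIntegral_levyIntensity_prod (ν := ν) t {y | ε < ‖y‖} (g := fun _ => 1)
        measurable_const
      simp only [lintegral_const, one_mul, Measure.restrict_apply_univ] at this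
      rw [jumpSet, this]
      finiteness
    refine (lt_of_le_of_lt (lintegral_mono (g := (jumpSet d t ε).indicator 1) fun p => ?_) ?_).ne
    · by_cases hp : p ∈ jumpSet d t ε
      · simp [hp]
      · simp [h, hp]
    · rwa [lintegral_indicator_one hS]
  let c : ℝ := inner ℝ (∫ y in {y : EuclideanSpace ℝ (Fin d) | ε < ‖y‖},
    chi (levyOrder ν) y • y ∂ν) ξ
  have hW : ∀ᵐ ω ∂P, (inner ℝ (truncatedJumpSum ν J t ε ω) ξ : ℝ)
      = ∫ p, h p ∂(J ω) - t * c := by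
    filter_upwards [ae_integrableOn_jumpSet hν hJ t hε] with ω hω
    rw [truncatedJumpSum, inner_sub_left, real_inner_smul_left, integral_indicator hS]
    congr 1
    have h1 := integral_inner (𝕜 := ℝ) hω ξ
    rw [real_inner_comm, ← h1]
    simp_rw [real_inner_comm]
  have hexp : ∀ᵐ ω ∂P, Complex.exp
      ((inner ℝ (truncatedJumpSum ν J t ε ω) ξ : ℝ) * Complex.I)
      = Complex.exp (-(t * c : ℝ) * Complex.I)
        * Complex.exp ((∫ p, h p ∂(J ω) : ℝ) * Complex.I) := by
    filter_upwards [hW] with ω hω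
    rw [hω, ← Complex.exp_add]
    congr 1
    push_cast
    ring
  have hmeas := poissonRandomMeasure_aemeasurable_integral hJ hh
    (poissonRandomMeasure_ae_integrable hJ hh hhint)
  refine ⟨?_, ?_⟩
  · exact AEStronglyMeasurable.congr (AEMeasurable.aestronglyMeasurable (by fun_prop))
      (hexp.mono fun _ h => h.symm)
  rw [integral_congr_ae hexp, integral_const_mul,
    poissonRandomMeasure_integral_exp hJ hh hhint, ← Complex.exp_add]
  congr 1
  have h2 : ∫ p, (Complex.exp (h p * Complex.I) - 1) ∂(levyIntensity ν)
      = t * ∫ y in {y | ε < ‖y‖}, (Complex.exp ((inner ℝ y ξ : ℝ) * Complex.I) - 1) ∂ν := by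
    have h3 : ∀ p, Complex.exp (h p * Complex.I) - 1 = (jumpSet d t ε).indicator
        (fun p => Complex.exp ((inner ℝ p.2 ξ : ℝ) * Complex.I) - 1) p := by
      intro p
      by_cases hp : p ∈ jumpSet d t ε
      · simp [h, hp]
      · simp [h, hp]
    simp_rw [h3]
    rw [integral_indicator hS]
    have := setIntegral_levyIntensity_prod (ν := ν) ht {y | ε < ‖y‖}
      (fun y => Complex.exp ((inner ℝ y ξ : ℝ) * Complex.I) - 1)
    rw [Complex.real_smul] at this
    exact this
  have hi1 : IntegrableOn (fun y => Complex.exp ((inner ℝ y ξ : ℝ) * Complex.I) - 1)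
      {y | ε < ‖y‖} ν := by
    refine Measure.integrableOn_of_bounded (M := 2) hνB.ne
      (Measurable.aestronglyMeasurable (by fun_prop)) (ae_of_all _ fun y => ?_)
    refine (norm_sub_le _ _).trans ?_
    rw [Complex.norm_exp_ofReal_mul_I, norm_one]
    norm_num
  have hi2 := (integrable_levySymbolIntegrand hα hρ ξ).integrableOn (s := {y | ε < ‖y‖})
  have hi3 : IntegrableOn (fun y => chi (levyOrder ν) y • y) {y | ε < ‖y‖} ν := by
    rw [IntegrableOn] at *
    refine Integrable.mono' (g := fun y => (1 + ε⁻¹) * levyEnvelope (levyOrder ν) y)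
      (hρ.integrableOn.const_mul _) (Measurable.aestronglyMeasurable (by fun_prop)) ?_
    filter_upwards [ae_restrict_mem hB] with y hy
    have hy : ε < ‖y‖ := hy
    have hy0 : 0 < ‖y‖ := hε.trans hy
    have hεy : 1 ≤ ε⁻¹ * ‖y‖ := by
      rw [inv_mul_eq_div, one_le_div hε]; exact hy.le
    have hε' : 0 < ε⁻¹ := inv_pos.2 hε
    rw [norm_smul, Real.norm_of_nonneg (chi_nonneg _ _)]
    have h0 := levyEnvelope_nonneg (levyOrder ν) y
    rcases lt_trichotomy (levyOrder ν) 1 with h | h | h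
    · rw [chi_of_lt h, zero_mul]
      positivity
    · rw [h] at h0 ⊢
      rw [chi_one]
      by_cases hy1 : ‖y‖ ≤ 1
      · simp only [levyEnvelope, hy1, if_true, lt_irrefl, if_false]
        nlinarith [sq_nonneg ‖y‖]
      · simp only [hy1, if_false, zero_mul]
        positivity
    · rw [chi_of_gt h hα.2]
      simp only [levyEnvelope, h, h.not_gt, if_true, if_false]
      split_ifs
      · nlinarith [sq_nonneg ‖y‖]
      · nlinarith
  have h4 : ∫ y in {y | ε < ‖y‖}, levySymbolIntegrand (levyOrder ν) ξ y ∂ν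
      = (∫ y in {y | ε < ‖y‖}, (Complex.exp ((inner ℝ y ξ : ℝ) * Complex.I) - 1) ∂ν)
        - c * Complex.I := by
    have h5 : ∫ y in {y | ε < ‖y‖}, ((inner ℝ (chi (levyOrder ν) y • y) ξ : ℝ) : ℂ) * Complex.I ∂ν
        = c * Complex.I := by
      rw [integral_mul_const, integral_complex_ofReal]
      congr 2
      have h1 := integral_inner (𝕜 := ℝ) hi3 ξ
      simp only [c]
      rw [real_inner_comm, ← h1]
      simp_rw [real_inner_comm]
    have hi4 : IntegrableOn
        (fun y => ((inner ℝ (chi (levyOrder ν) y • y) ξ : ℝ) : ℂ) * Complex.I) {y | ε < ‖y‖} ν :=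
      ((Integrable.inner_const (𝕜 := ℝ) hi3 ξ).ofReal).mul_const _
    rw [← h5, ← integral_sub hi1 hi4]
    refine integral_congr_ae (ae_of_all _ fun y => ?_)
    simp only [levySymbolIntegrand, real_inner_smul_left, Complex.real_smul]
    push_cast
    ring
  rw [h2, h4]
  push_cast
  ring

/-- The **Lévy–Khintchine formula** for the process `Z`. Along a sequence `ε → 0` the compensated
sums of the jumps larger than `ε` converge almost surely to `Z_t`, and their characteristic functions
converge to `e^{t ψ}`. -/
theorem charFun_levyProcess [IsProbabilityMeasure P] (hν : IsLevyMeasure ν)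
    (hα : levyOrder ν ∈ Ioo (0 : ℝ) 2) (hρ : Integrable (levyEnvelope (levyOrder ν)) ν)
    (hZ : IsLevyProcessOf P ν J Z) {t : ℝ} (ht : 0 ≤ t) (ξ : EuclideanSpace ℝ (Fin d)) :
    charFun (P.map (Z t)) ξ = Complex.exp (t * levySymbol ν ξ) := by
  have hJ := hZ.poisson
  obtain ⟨Y, hY, hZY⟩ := hZ.eq_integral t ht
  obtain ⟨ε, hε, hεY⟩ := TendstoInMeasure.exists_seq_tendsto_ae' hY
  rw [tendsto_nhdsWithin_iff] at hε
  obtain ⟨hε0, hεpos⟩ := hε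
  -- The terms of the sequence are positive only from some index `n₀` on, hence the shift by `n₀`.
  obtain ⟨n₀, hn₀⟩ := eventually_atTop.1 hεpos
  have hall : ∀ᵐ ω ∂P, ∀ n, IntegrableOn (fun p : ℝ × EuclideanSpace ℝ (Fin d) => p.2)
      (jumpSet d t (ε (n + n₀))) (J ω) :=
    ae_all_iff.2 fun n => ae_integrableOn_jumpSet hν hJ t (hn₀ _ (Nat.le_add_left _ _))
  have hW : ∀ᵐ ω ∂P, Tendsto (fun n => truncatedJumpSum ν J t (ε (n + n₀)) ω) atTop
      (𝓝 (Z t ω)) := by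
    filter_upwards [hall, hεY, hZY, ae_integrableOn_largeJumps hν hα hρ hJ t]
      with ω h1 h2 h3 h4
    rw [h3]
    -- The uncompensated part converges by dominated convergence; jumps of size `0` contribute nothing.
    have h5 : Tendsto (fun n => ∫ p in jumpSet d t (ε (n + n₀)),
        (1 - chi (levyOrder ν) p.2) • p.2 ∂(J ω)) atTop
        (𝓝 (∫ p in Ioc (0 : ℝ) t ×ˢ (univ : Set (EuclideanSpace ℝ (Fin d))),
          (1 - chi (levyOrder ν) p.2) • p.2 ∂(J ω))) := by
      have h6 : ∀ n, ∫ p in jumpSet d t (ε (n + n₀)), (1 - chi (levyOrder ν) p.2) • p.2 ∂(J ω)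
          = ∫ p in Ioc (0 : ℝ) t ×ˢ (univ : Set (EuclideanSpace ℝ (Fin d))),
            (jumpSet d t (ε (n + n₀))).indicator
              (fun p => (1 - chi (levyOrder ν) p.2) • p.2) p ∂(J ω) := by
        intro n
        rw [setIntegral_indicator (measurableSet_jumpSet t _)]
        congr 2
        rw [jumpSet, prod_inter_prod, inter_self, univ_inter]
      simp_rw [h6]
      refine tendsto_integral_of_dominated_convergence _
        (fun n => h4.1.indicator (measurableSet_jumpSet t _)) h4.norm
        (fun n => ae_of_all _ fun p => norm_indicator_le_norm_self _ _) ?_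
      filter_upwards [ae_restrict_mem (measurableSet_Ioc.prod MeasurableSet.univ)] with p hp
      refine tendsto_const_nhds.congr' ?_
      by_cases hp0 : p.2 = 0
      · refine Eventually.of_forall fun n => ?_
        simp [indicator, hp0]
      · have : ∀ᶠ n in atTop, ε (n + n₀) < ‖p.2‖ :=
          ((tendsto_add_atTop_iff_nat n₀).2 hε0).eventually_lt_const (norm_pos_iff.2 hp0)
        filter_upwards [this] with n hn
        rw [indicator_of_mem]
        exact ⟨hp.1, hn⟩
    refine (((tendsto_add_atTop_iff_nat n₀).2 h2).add h5).congr fun n => ?_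
    rw [truncatedJumpSum, sub_add_eq_add_sub]
    congr 1
    have h7 : IntegrableOn (fun p : ℝ × EuclideanSpace ℝ (Fin d) =>
        chi (levyOrder ν) p.2 • p.2) (jumpSet d t (ε (n + n₀))) (J ω) := by
      refine Integrable.mono (h1 n) (Measurable.aestronglyMeasurable (by fun_prop))
        (ae_of_all _ fun p => ?_)
      rw [norm_smul, Real.norm_of_nonneg (chi_nonneg _ _)]
      exact mul_le_of_le_one_left (norm_nonneg _) (chi_le_one _ _)
    have h8 : IntegrableOn (fun p : ℝ × EuclideanSpace ℝ (Fin d) =>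
        (1 - chi (levyOrder ν) p.2) • p.2) (jumpSet d t (ε (n + n₀))) (J ω) :=
      h4.mono_set (prod_mono_right (subset_univ _))
    rw [jumpSet] at h7 h8 ⊢
    rw [← integral_add h7 h8]
    refine integral_congr_ae (ae_of_all _ fun p => ?_)
    simp only
    rw [← add_smul]
    simp
  have hl : Tendsto (fun n => ∫ ω, Complex.exp
      ((inner ℝ (truncatedJumpSum ν J t (ε (n + n₀)) ω) ξ : ℝ) * Complex.I) ∂P) atTop
      (𝓝 (∫ ω, Complex.exp ((inner ℝ (Z t ω) ξ : ℝ) * Complex.I) ∂P)) := by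
    refine tendsto_integral_of_dominated_convergence (fun _ => 1)
      (fun n => (integral_exp_truncatedJumpSum hν hα hρ hJ ht
        (hn₀ _ (Nat.le_add_left _ _)) ξ).1) (integrable_const _)
      (fun n => ae_of_all _ fun ω => by rw [Complex.norm_exp_ofReal_mul_I]) ?_
    filter_upwards [hW] with ω hω
    have : Continuous fun z : EuclideanSpace ℝ (Fin d) =>
      Complex.exp ((inner ℝ z ξ : ℝ) * Complex.I) := by fun_prop
    exact (this.tendsto _).comp hω
  have hr : Tendsto (fun n => Complex.exp (t * ∫ y in {y | ε (n + n₀) < ‖y‖},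
      levySymbolIntegrand (levyOrder ν) ξ y ∂ν)) atTop
      (𝓝 (Complex.exp (t * levySymbol ν ξ))) := by
    refine (Complex.continuous_exp.tendsto _).comp (Tendsto.const_mul _ ?_)
    simp_rw [← integral_indicator (measurableSet_norm_gt _)]
    have hi := integrable_levySymbolIntegrand hα hρ ξ
    refine tendsto_integral_of_dominated_convergence _
      (fun n => hi.1.indicator (measurableSet_norm_gt _)) hi.norm
      (fun n => ae_of_all _ fun p => norm_indicator_le_norm_self _ _) (ae_of_all _ fun y => ?_)
    refine tendsto_const_nhds.congr' ?_
    by_cases hy0 : y = 0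
    · refine Eventually.of_forall fun n => ?_
      simp [indicator, hy0, levySymbolIntegrand]
    · have : ∀ᶠ n in atTop, ε (n + n₀) < ‖y‖ :=
        ((tendsto_add_atTop_iff_nat n₀).2 hε0).eventually_lt_const (norm_pos_iff.2 hy0)
      filter_upwards [this] with n hn
      rw [indicator_of_mem]
      exact hn
  rw [charFun_apply, integral_map (hZ.aemeasurable t ht)
    (Measurable.aestronglyMeasurable (by fun_prop))]
  refine tendsto_nhds_unique hl (hr.congr fun n => ?_)
  exact (integral_exp_truncatedJumpSum hν hα hρ hJ ht (hn₀ _ (Nat.le_add_left _ _)) ξ).2.symm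

end LevyProcess

/-! ### Weak continuity of the laws -/

section WeakContinuity

variable {d : ℕ} {ν : Measure (EuclideanSpace ℝ (Fin d))}

/-- `μ` is the family of one-dimensional laws of a Lévy process with exponent `levySymbol ν`. For
convenience the family is indexed by all real times, and constant for negative ones. -/
def HasLevyLaws (ν : Measure (EuclideanSpace ℝ (Fin d)))
    (μ : ℝ → ProbabilityMeasure (EuclideanSpace ℝ (Fin d))) : Prop :=
  ∀ r ξ, charFun (μ r : Measure (EuclideanSpace ℝ (Fin d))) ξ
    = Complex.exp ((max r 0 : ℝ) * levySymbol ν ξ)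

variable {μ : ℝ → ProbabilityMeasure (EuclideanSpace ℝ (Fin d))}

/-- Weak continuity in time, by Lévy's continuity theorem. -/
lemma HasLevyLaws.continuous (hμ : HasLevyLaws ν μ) : Continuous μ := by
  refine continuous_iff_seqContinuous.2 fun r r₀ hr => ?_
  refine ProbabilityMeasure.tendsto_of_tendsto_charFun fun ξ => ?_
  simp only [Function.comp, hμ _ ξ]
  have : Continuous fun r : ℝ => Complex.exp ((max r 0 : ℝ) * levySymbol ν ξ) := by fun_prop
  exact (this.tendsto r₀).comp hr

/-- Integration of a jointly continuous function against a weakly continuous family of laws is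
jointly continuous. The parameter is absorbed into the measure as a Dirac factor. -/
lemma continuous_integral_of_continuous_probabilityMeasure_real {A E : Type*}
    [MeasurableSpace A] [TopologicalSpace A] [BorelSpace A] [SecondCountableTopology A]
    [TopologicalSpace.PseudoMetrizableSpace A]
    [TopologicalSpace E] [MeasurableSpace E] [BorelSpace E] [SecondCountableTopology E]
    [TopologicalSpace.PseudoMetrizableSpace E]
    {μ : A → ProbabilityMeasure E} (hμ : Continuous μ) {h : A → E → ℝ}
    (hh : Continuous fun p : A × E => h p.1 p.2) {C : ℝ} (hC : ∀ a z, ‖h a z‖ ≤ C) :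
    Continuous fun a => ∫ z, h a z ∂(μ a : Measure E) := by
  let F : BoundedContinuousFunction (A × E) ℝ :=
    BoundedContinuousFunction.ofNormedAddCommGroup (fun p => h p.1 p.2) hh C fun p => hC _ _
  have h1 : Continuous fun a => (diracProba a).prod (μ a) :=
    ProbabilityMeasure.continuous_prod.comp (continuous_diracProba.prodMk hμ)
  have h2 : Continuous fun a => ∫ p, F p ∂((diracProba a).prod (μ a) : Measure (A × E)) := by
    rw [continuous_iff_continuousAt] at h1 ⊢
    intro a
    exact ProbabilityMeasure.tendsto_iff_forall_integral_tendsto.1 (h1 a) F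
  refine h2.congr fun a => ?_
  have h3 : ((diracProba a).prod (μ a) : Measure (A × E))
      = (Measure.dirac a).prod (μ a : Measure E) := rfl
  rw [h3, Measure.dirac_prod]
  exact integral_map (by fun_prop) F.continuous.aestronglyMeasurable

/-- The version for functions with values in a finite-dimensional space, by coordinates. -/
lemma continuous_integral_of_continuous_probabilityMeasure {A E V : Type*}
    [MeasurableSpace A] [TopologicalSpace A] [BorelSpace A] [SecondCountableTopology A]
    [TopologicalSpace.PseudoMetrizableSpace A]
    [TopologicalSpace E] [MeasurableSpace E] [BorelSpace E] [SecondCountableTopology E]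
    [TopologicalSpace.PseudoMetrizableSpace E]
    [NormedAddCommGroup V] [NormedSpace ℝ V] [FiniteDimensional ℝ V]
    {μ : A → ProbabilityMeasure E} (hμ : Continuous μ) {h : A → E → V}
    (hh : Continuous fun p : A × E => h p.1 p.2) {C : ℝ} (hC : ∀ a z, ‖h a z‖ ≤ C) :
    Continuous fun a => ∫ z, h a z ∂(μ a : Measure E) := by
  let e : V ≃L[ℝ] (Fin (Module.finrank ℝ V) → ℝ) :=
    ContinuousLinearEquiv.ofFinrankEq (by simp)
  have hint : ∀ a, Integrable (h a) (μ a : Measure E) := by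
    intro a
    refine Integrable.of_bound (Continuous.aestronglyMeasurable (by fun_prop)) C
      (ae_of_all _ fun z => hC a z)
  rw [← e.comp_continuous_iff, continuous_pi_iff]
  intro i
  let L : V →L[ℝ] ℝ := (ContinuousLinearMap.proj (R := ℝ) (φ := fun _ => ℝ) i).comp
    (e : V →L[ℝ] (Fin _ → ℝ))
  have : (fun a => (e ∘ fun a => ∫ z, h a z ∂(μ a : Measure E)) a i)
      = fun a => ∫ z, L (h a z) ∂(μ a : Measure E) := by
    ext a
    rw [L.integral_comp_comm (hint a)]
    rfl
  rw [this]
  refine continuous_integral_of_continuous_probabilityMeasure_real hμ (C := ‖L‖ * C)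
    (by fun_prop) fun a z => ?_
  exact (L.le_opNorm _).trans (by gcongr; exact hC a z)

end WeakContinuity

/-! ### Bounds for the Lévy operator -/

section Generator

variable {d : ℕ} {ν : Measure (EuclideanSpace ℝ (Fin d))}

/-- Smooth functions whose values, first derivatives and Lipschitz constants of the first
derivatives are bounded by `C`. -/
structure IsC2Bounded (C : ℝ) (g : EuclideanSpace ℝ (Fin d) → ℝ) : Prop where
  contDiff : ContDiff ℝ ((⊤ : ℕ∞) : WithTop ℕ∞) g
  norm_le : ∀ x, ‖g x‖ ≤ C
  norm_fderiv_le : ∀ x, ‖fderiv ℝ g x‖ ≤ C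
  norm_fderiv_sub_le : ∀ x y, ‖fderiv ℝ g x - fderiv ℝ g y‖ ≤ C * ‖x - y‖

/-- The integrand of the Lévy operator. -/
def levyIntegrand (α : ℝ) (g : EuclideanSpace ℝ (Fin d) → ℝ) (x y : EuclideanSpace ℝ (Fin d)) :
    ℝ :=
  g (x + y) - g x - chi α y * fderiv ℝ g x y

lemma IsC2Bounded.differentiable {C : ℝ} {g : EuclideanSpace ℝ (Fin d) → ℝ}
    (hg : IsC2Bounded C g) : Differentiable ℝ g :=
  hg.contDiff.differentiable (by simp)

lemma IsC2Bounded.norm_levyIntegrand_le {α : ℝ} (hα : α ∈ Ioo (0 : ℝ) 2) {C : ℝ}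
    {g : EuclideanSpace ℝ (Fin d) → ℝ} (hg : IsC2Bounded C g) (x y : EuclideanSpace ℝ (Fin d)) :
    ‖levyIntegrand α g x y‖ ≤ 4 * C * levyEnvelope α y := by
  have hC : 0 ≤ C := (norm_nonneg _).trans (hg.norm_le 0)
  have hy := norm_nonneg y
  have := norm_sub_chi_smul_le hα y (C := 2 * C) (a := g (x + y) - g x) (b := fderiv ℝ g x y)
    ?_ ?_ ?_ ?_
  · unfold levyIntegrand
    rw [smul_eq_mul] at this
    linarith
  · refine (norm_sub_le _ _).trans ?_
    linarith [hg.norm_le (x + y), hg.norm_le x]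
  · have := convex_univ.norm_image_sub_le_of_norm_fderiv_le (𝕜 := ℝ) (f := g) (C := C)
      (fun z _ => hg.differentiable z) (fun z _ => hg.norm_fderiv_le z) (mem_univ x)
      (mem_univ (x + y))
    rw [add_sub_cancel_left] at this
    nlinarith
  · refine ((fderiv ℝ g x).le_opNorm y).trans ?_
    gcongr
    linarith [hg.norm_fderiv_le x]
  · have := (convex_closedBall x ‖y‖).norm_image_sub_le_of_norm_fderiv_le' (𝕜 := ℝ) (f := g)
      (C := C * ‖y‖) (φ := fderiv ℝ g x) (fun z _ => hg.differentiable z) (fun z hz => ?_)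
      (Metric.mem_closedBall_self hy) (y := x + y) (by simp)
    · rw [add_sub_cancel_left] at this
      nlinarith
    · refine (hg.norm_fderiv_sub_le z x).trans ?_
      gcongr
      exact mem_closedBall_iff_norm.1 hz

lemma measurable_levyIntegrand (α : ℝ) {g : EuclideanSpace ℝ (Fin d) → ℝ}
    (hg : Measurable g) (x : EuclideanSpace ℝ (Fin d)) : Measurable (levyIntegrand α g x) := by
  unfold levyIntegrand
  fun_prop

lemma IsC2Bounded.integrable_levyIntegrand (hα : levyOrder ν ∈ Ioo (0 : ℝ) 2)
    (hρ : Integrable (levyEnvelope (levyOrder ν)) ν) {C : ℝ}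
    {g : EuclideanSpace ℝ (Fin d) → ℝ} (hg : IsC2Bounded C g) (x : EuclideanSpace ℝ (Fin d)) :
    Integrable (levyIntegrand (levyOrder ν) g x) ν :=
  (hρ.const_mul (4 * C)).mono'
    (measurable_levyIntegrand _ hg.contDiff.continuous.measurable x).aestronglyMeasurable
    (ae_of_all _ (hg.norm_levyIntegrand_le hα x))

lemma IsC2Bounded.norm_levyOp_le (hα : levyOrder ν ∈ Ioo (0 : ℝ) 2)
    (hρ : Integrable (levyEnvelope (levyOrder ν)) ν) {C : ℝ}
    {g : EuclideanSpace ℝ (Fin d) → ℝ} (hg : IsC2Bounded C g) (x : EuclideanSpace ℝ (Fin d)) :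
    ‖levyOp ν g x‖ ≤ 4 * C * ∫ y, levyEnvelope (levyOrder ν) y ∂ν := by
  rw [← integral_const_mul]
  exact norm_integral_le_of_norm_le (hρ.const_mul _)
    (ae_of_all _ (hg.norm_levyIntegrand_le hα x))

/-- Continuity of the Lévy operator along a filter, under pointwise convergence of the functions
and their gradients, and uniform bounds. -/
lemma tendsto_levyOp (hα : levyOrder ν ∈ Ioo (0 : ℝ) 2)
    (hρ : Integrable (levyEnvelope (levyOrder ν)) ν) {ι : Type*} {l : Filter ι}
    [l.IsCountablyGenerated] {C : ℝ} {g : ι → EuclideanSpace ℝ (Fin d) → ℝ}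
    (hg : ∀ i, IsC2Bounded C (g i)) {x : ι → EuclideanSpace ℝ (Fin d)}
    {g₀ : EuclideanSpace ℝ (Fin d) → ℝ} {x₀ : EuclideanSpace ℝ (Fin d)}
    (h0 : ∀ y, Tendsto (fun i => g i (x i + y)) l (𝓝 (g₀ (x₀ + y))))
    (h1 : Tendsto (fun i => fderiv ℝ (g i) (x i)) l (𝓝 (fderiv ℝ g₀ x₀))) :
    Tendsto (fun i => levyOp ν (g i) (x i)) l (𝓝 (levyOp ν g₀ x₀)) := by
  refine tendsto_integral_filter_of_dominated_convergence
    (fun y => 4 * C * levyEnvelope (levyOrder ν) y)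
    (Eventually.of_forall fun i => ((hg i).integrable_levyIntegrand hα hρ (x i)).1)
    (Eventually.of_forall fun i => ae_of_all _ ((hg i).norm_levyIntegrand_le hα (x i)))
    (hρ.const_mul _) (ae_of_all _ fun y => ?_)
  have h00 := h0 0
  simp only [add_zero] at h00
  exact ((h0 y).sub h00).sub
    ((((ContinuousLinearMap.apply ℝ ℝ y).continuous.tendsto _).comp h1).const_mul _)

lemma IsC2Bounded.continuous_levyOp (hα : levyOrder ν ∈ Ioo (0 : ℝ) 2)
    (hρ : Integrable (levyEnvelope (levyOrder ν)) ν) {C : ℝ}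
    {g : EuclideanSpace ℝ (Fin d) → ℝ} (hg : IsC2Bounded C g) : Continuous (levyOp ν g) := by
  refine continuous_iff_continuousAt.2 fun x => ?_
  refine tendsto_levyOp hα hρ (fun _ => hg) (fun y => ?_) ?_
  · have : Continuous fun x => g (x + y) := hg.contDiff.continuous.comp (by fun_prop)
    exact this.tendsto x
  · exact (hg.contDiff.continuous_fderiv (by simp)).tendsto x

/-- Smooth functions with bounded first and second derivatives satisfy the bounds. -/
lemma IsC2Bounded.of_iteratedFDeriv {g : EuclideanSpace ℝ (Fin d) → ℝ} {C : ℝ}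
    (hg : ContDiff ℝ ((⊤ : ℕ∞) : WithTop ℕ∞) g) (h0 : ∀ x, ‖iteratedFDeriv ℝ 0 g x‖ ≤ C)
    (h1 : ∀ x, ‖iteratedFDeriv ℝ 1 g x‖ ≤ C) (h2 : ∀ x, ‖iteratedFDeriv ℝ 2 g x‖ ≤ C) :
    IsC2Bounded C g := by
  refine ⟨hg, fun x => by simpa using h0 x, fun x => ?_, fun x y => ?_⟩
  · simpa using h1 x
  · refine convex_univ.norm_image_sub_le_of_norm_fderiv_le (𝕜 := ℝ) (f := fderiv ℝ g) (C := C)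
      (fun z _ => ?_) (fun z _ => ?_) (mem_univ y) (mem_univ x)
    · exact (hg.fderiv_right (m := 1) (by norm_cast)).differentiable (by simp) z
    · have := h2 z
      rwa [← norm_iteratedFDeriv_fderiv (n := 1), norm_iteratedFDeriv_one] at this

lemma IsC2Bounded.exists_of_hasCompactSupport {g : EuclideanSpace ℝ (Fin d) → ℝ}
    (hg : ContDiff ℝ ((⊤ : ℕ∞) : WithTop ℕ∞) g) (hc : HasCompactSupport g) :
    ∃ C, IsC2Bounded C g := by
  have h : ∀ k : ℕ, ∃ C, ∀ x, ‖iteratedFDeriv ℝ k g x‖ ≤ C := fun k =>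
    (hg.continuous_iteratedFDeriv (by exact_mod_cast le_top)).bounded_above_of_compact_support
      (hc.iteratedFDeriv k)
  obtain ⟨C0, h0⟩ := h 0
  obtain ⟨C1, h1⟩ := h 1
  obtain ⟨C2, h2⟩ := h 2
  exact ⟨max C0 (max C1 C2), IsC2Bounded.of_iteratedFDeriv hg
    (fun x => (h0 x).trans (by simp)) (fun x => (h1 x).trans (by simp))
    (fun x => (h2 x).trans (by simp))⟩

lemma IsC2Bounded.mul {A B : ℝ} {f g : EuclideanSpace ℝ (Fin d) → ℝ} (hf : IsC2Bounded A f)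
    (hg : IsC2Bounded B g) : IsC2Bounded (4 * (A * B)) (fun x => f x * g x) := by
  have hA : 0 ≤ A := (norm_nonneg _).trans (hf.norm_le 0)
  have hB : 0 ≤ B := (norm_nonneg _).trans (hg.norm_le 0)
  have hAB := mul_nonneg hA hB
  have hLip : ∀ {C : ℝ} {g : EuclideanSpace ℝ (Fin d) → ℝ}, IsC2Bounded C g → ∀ x y,
      ‖g x - g y‖ ≤ C * ‖x - y‖ := fun hg x y =>
    convex_univ.norm_image_sub_le_of_norm_fderiv_le (𝕜 := ℝ)
      (fun z _ => hg.differentiable z) (fun z _ => hg.norm_fderiv_le z) (mem_univ y) (mem_univ x)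
  have hD : ∀ x, fderiv ℝ (fun x => f x * g x) x = f x • fderiv ℝ g x + g x • fderiv ℝ f x :=
    fun x => fderiv_fun_mul (hf.differentiable x) (hg.differentiable x)
  refine ⟨hf.contDiff.mul hg.contDiff, fun x => ?_, fun x => ?_, fun x y => ?_⟩
  · rw [norm_mul]
    have := mul_le_mul (hf.norm_le x) (hg.norm_le x) (norm_nonneg _) hA
    linarith
  · rw [hD]
    refine (norm_add_le _ _).trans ?_
    rw [norm_smul, norm_smul]
    have h1 := mul_le_mul (hf.norm_le x) (hg.norm_fderiv_le x) (norm_nonneg _) hA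
    have h2 := mul_le_mul (hg.norm_le x) (hf.norm_fderiv_le x) (norm_nonneg _) hB
    linarith
  · rw [hD, hD]
    have hsplit : f x • fderiv ℝ g x + g x • fderiv ℝ f x
          - (f y • fderiv ℝ g y + g y • fderiv ℝ f y)
        = (f x • (fderiv ℝ g x - fderiv ℝ g y) + (f x - f y) • fderiv ℝ g y)
          + (g x • (fderiv ℝ f x - fderiv ℝ f y) + (g x - g y) • fderiv ℝ f y) := by
      simp only [smul_sub, sub_smul]
      abel
    rw [hsplit]
    refine (norm_add_le _ _).trans (le_trans (add_le_add (norm_add_le _ _) (norm_add_le _ _)) ?_)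
    simp only [norm_smul]
    have hxy := norm_nonneg (x - y)
    have h1 := mul_le_mul (hf.norm_le x) (hg.norm_fderiv_sub_le x y) (norm_nonneg _) hA
    have h2 := mul_le_mul (hLip hf x y) (hg.norm_fderiv_le y) (norm_nonneg _)
      (mul_nonneg hA hxy)
    have h3 := mul_le_mul (hg.norm_le x) (hf.norm_fderiv_sub_le x y) (norm_nonneg _) hB
    have h4 := mul_le_mul (hLip hg x y) (hf.norm_fderiv_le y) (norm_nonneg _)
      (mul_nonneg hB hxy)
    linarith

/-- Dilating by a factor at most `1` preserves the bounds. -/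
lemma IsC2Bounded.comp_smul {C : ℝ} {g : EuclideanSpace ℝ (Fin d) → ℝ} (hg : IsC2Bounded C g)
    {c : ℝ} (hc0 : 0 ≤ c) (hc1 : c ≤ 1) : IsC2Bounded C (fun x => g (c • x)) := by
  have hC : 0 ≤ C := (norm_nonneg _).trans (hg.norm_le 0)
  have hD : ∀ x, fderiv ℝ (fun x => g (c • x)) x = c • fderiv ℝ g (c • x) := fun x =>
    fderiv_comp_smul c
  refine ⟨hg.contDiff.comp (by fun_prop), fun x => hg.norm_le _, fun x => ?_, fun x y => ?_⟩
  · rw [hD, norm_smul, Real.norm_of_nonneg hc0]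
    exact (mul_le_of_le_one_left (norm_nonneg _) hc1).trans (hg.norm_fderiv_le _)
  · rw [hD, hD, ← smul_sub, norm_smul, Real.norm_of_nonneg hc0]
    refine (mul_le_of_le_one_left (norm_nonneg _) hc1).trans
      ((hg.norm_fderiv_sub_le _ _).trans ?_)
    rw [← smul_sub, norm_smul, Real.norm_of_nonneg hc0]
    gcongr
    exact mul_le_of_le_one_left (norm_nonneg _) hc1

end Generator

/-! ### The forward equation for test functions -/

section Fourier

variable {d : ℕ} {ν : Measure (EuclideanSpace ℝ (Fin d))}
  {μ : ℝ → ProbabilityMeasure (EuclideanSpace ℝ (Fin d))}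

/-- `g` is a superposition of the characters `x ↦ e^{i x·θ}`, `θ = -2πξ`, with a density `φ(ξ)` that
has finite second moments, and so is its derivative. The factor `-2π` is the one of Mathlib's Fourier
transform. -/
structure IsFourierSuperposition (φ : EuclideanSpace ℝ (Fin d) → ℂ)
    (g : EuclideanSpace ℝ (Fin d) → ℝ) : Prop where
  measurable : Measurable φ
  integrable : Integrable fun ξ => (1 + ‖(-2 * Real.pi) • ξ‖) ^ 2 * ‖φ ξ‖
  eq_integral : ∀ x, (g x : ℂ)
    = ∫ ξ, Complex.exp ((inner ℝ x ((-2 * Real.pi) • ξ) : ℝ) * Complex.I) * φ ξ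
  fderiv_eq_integral : ∀ x y, (fderiv ℝ g x y : ℂ)
    = ∫ ξ, Complex.exp ((inner ℝ x ((-2 * Real.pi) • ξ) : ℝ) * Complex.I)
      * (((inner ℝ y ((-2 * Real.pi) • ξ) : ℝ) * Complex.I) * φ ξ)

/-- Fourier inversion for test functions. -/
lemma exists_isFourierSuperposition {g : EuclideanSpace ℝ (Fin d) → ℝ}
    (hg : ContDiff ℝ ((⊤ : ℕ∞) : WithTop ℕ∞) g) (hc : HasCompactSupport g) :
    ∃ φ, IsFourierSuperposition φ g := by
  let G : SchwartzMap (EuclideanSpace ℝ (Fin d)) ℂ :=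
    HasCompactSupport.toSchwartzMap (f := fun x => (g x : ℂ))
      (hc.comp_left (g := fun y : ℝ => (y : ℂ)) (by simp)) (Complex.ofRealCLM.contDiff.comp hg)
  let φ : SchwartzMap (EuclideanSpace ℝ (Fin d)) ℂ := 𝓕⁻ G
  have hφ : 𝓕 φ = G := FourierTransform.fourier_fourierInv_eq G
  have hint0 : Integrable φ := φ.integrable
  have hker : ∀ x ξ : EuclideanSpace ℝ (Fin d), (-2 * Real.pi * inner ℝ ξ x : ℝ)
      = inner ℝ x ((-2 * Real.pi) • ξ) := fun x ξ => by
    rw [real_inner_smul_right, real_inner_comm]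
  refine ⟨φ, φ.continuous.measurable, ?_, fun x => ?_, fun x y => ?_⟩
  · have h1 : Integrable fun ξ => ‖ξ‖ * ‖φ ξ‖ := by simpa using φ.integrable_pow_mul volume 1
    have h2 : Integrable fun ξ => ‖ξ‖ ^ 2 * ‖φ ξ‖ := φ.integrable_pow_mul volume 2
    have h3 := (hint0.norm.add (h1.const_mul (2 * (2 * Real.pi)))).add
      (h2.const_mul ((2 * Real.pi) ^ 2))
    refine h3.congr (ae_of_all _ fun ξ => ?_)
    simp only [Pi.add_apply, norm_smul, norm_mul, norm_neg, Real.norm_ofNat,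
      Real.norm_of_nonneg Real.pi_pos.le]
    ring
  · have h1 : (g x : ℂ) = (𝓕 φ) x := by rw [hφ]; rfl
    rw [h1, SchwartzMap.fourier_coe, Real.fourier_eq']
    simp_rw [hker, smul_eq_mul]
  · have h1 : (fderiv ℝ g x y : ℂ) = fderiv ℝ G x y := by
      have h2 : HasFDerivAt (fun x => (g x : ℂ))
          (Complex.ofRealCLM.comp (fderiv ℝ g x)) x :=
        Complex.ofRealCLM.hasFDerivAt.comp x (hg.differentiable (by simp) x).hasFDerivAt
      have h3 : (G : EuclideanSpace ℝ (Fin d) → ℂ) = fun x => (g x : ℂ) := rfl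
      rw [h3, h2.fderiv]
      rfl
    have htg : (fun v : EuclideanSpace ℝ (Fin d) => (inner ℝ v y : ℝ)).HasTemperateGrowth :=
      ((innerSL ℝ).flip y).hasTemperateGrowth
    rw [h1, ← hφ, ← SchwartzMap.lineDerivOp_apply_eq_fderiv, SchwartzMap.lineDerivOp_fourier_eq,
      SchwartzMap.fourier_coe, Real.fourier_eq']
    refine integral_congr_ae (ae_of_all _ fun ξ => ?_)
    simp only [smul_eq_mul, smul_apply, SchwartzMap.smulLeftCLM_apply_apply htg,
      Complex.real_smul]
    rw [hker, ← hker y ξ]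
    push_cast
    ring

variable {φ : EuclideanSpace ℝ (Fin d) → ℂ} {g : EuclideanSpace ℝ (Fin d) → ℝ}

lemma IsFourierSuperposition.integrable_of_le (hφ : IsFourierSuperposition φ g)
    {F : EuclideanSpace ℝ (Fin d) → ℂ} (hF : Measurable F) {C : ℝ}
    (hC : ∀ ξ, ‖F ξ‖ ≤ C * (1 + ‖(-2 * Real.pi) • ξ‖) ^ 2) :
    Integrable fun ξ => F ξ * φ ξ := by
  refine (hφ.integrable.const_mul C).mono' (hF.mul hφ.measurable).aestronglyMeasurable
    (ae_of_all _ fun ξ => ?_)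
  rw [norm_mul, ← mul_assoc]
  gcongr
  exact hC ξ

lemma stronglyMeasurable_levySymbol (hν : IsLevyMeasure ν) :
    StronglyMeasurable (levySymbol ν) := by
  have := sigmaFinite_of_isLevyMeasure hν
  exact (measurable_levySymbolIntegrand _).stronglyMeasurable.integral_prod_right'

lemma norm_levySymbol_le (hα : levyOrder ν ∈ Ioo (0 : ℝ) 2)
    (hρ : Integrable (levyEnvelope (levyOrder ν)) ν) (ξ : EuclideanSpace ℝ (Fin d)) :
    ‖levySymbol ν ξ‖ ≤ (6 * ∫ y, levyEnvelope (levyOrder ν) y ∂ν) * (1 + ‖ξ‖) ^ 2 := by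
  have := norm_integral_le_of_norm_le (hρ.const_mul (6 * (1 + ‖ξ‖) ^ 2))
    (ae_of_all _ (norm_levySymbolIntegrand_le hα ξ))
  rw [integral_const_mul] at this
  unfold levySymbol
  linarith

lemma measurable_levySymbolIntegrand_smul (α c : ℝ) :
    Measurable fun p : EuclideanSpace ℝ (Fin d) × EuclideanSpace ℝ (Fin d) =>
      levySymbolIntegrand α (c • p.2) p.1 := by
  unfold levySymbolIntegrand
  fun_prop

/-- On superpositions of characters the Lévy operator acts as multiplication by its exponent. -/
lemma IsFourierSuperposition.levyOp_eq (hν : IsLevyMeasure ν)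
    (hα : levyOrder ν ∈ Ioo (0 : ℝ) 2) (hρ : Integrable (levyEnvelope (levyOrder ν)) ν)
    (hφ : IsFourierSuperposition φ g) (x : EuclideanSpace ℝ (Fin d)) :
    (levyOp ν g x : ℂ)
      = ∫ ξ, Complex.exp ((inner ℝ x ((-2 * Real.pi) • ξ) : ℝ) * Complex.I)
        * (levySymbol ν ((-2 * Real.pi) • ξ) * φ ξ) := by
  have := sigmaFinite_of_isLevyMeasure hν
  have hb1 : ∀ ξ : EuclideanSpace ℝ (Fin d), 1 ≤ 1 + ‖(-2 * Real.pi) • ξ‖ := fun ξ => by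
    linarith [norm_nonneg ((-2 * Real.pi) • ξ)]
  have h1 : ∀ y, ((levyIntegrand (levyOrder ν) g x y : ℝ) : ℂ)
      = ∫ ξ, Complex.exp ((inner ℝ x ((-2 * Real.pi) • ξ) : ℝ) * Complex.I)
        * (levySymbolIntegrand (levyOrder ν) ((-2 * Real.pi) • ξ) y * φ ξ) := by
    intro y
    have i1 : ∀ x : EuclideanSpace ℝ (Fin d), Integrable fun ξ =>
        Complex.exp ((inner ℝ x ((-2 * Real.pi) • ξ) : ℝ) * Complex.I) * φ ξ := fun x =>
      hφ.integrable_of_le (by fun_prop) (C := 1) fun ξ => by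
        rw [Complex.norm_exp_ofReal_mul_I, one_mul]
        exact one_le_pow₀ (hb1 ξ)
    have i2 : Integrable fun ξ =>
        (Complex.exp ((inner ℝ x ((-2 * Real.pi) • ξ) : ℝ) * Complex.I)
          * ((inner ℝ y ((-2 * Real.pi) • ξ) : ℝ) * Complex.I)) * φ ξ :=
      hφ.integrable_of_le (by fun_prop) (C := ‖y‖) fun ξ => by
        rw [norm_mul, Complex.norm_exp_ofReal_mul_I, one_mul, norm_mul, Complex.norm_I, mul_one,
          Complex.norm_real]
        refine (abs_real_inner_le_norm _ _).trans ?_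
        gcongr
        nlinarith [hb1 ξ, norm_nonneg ((-2 * Real.pi) • ξ)]
    have i3 := (i2.const_mul (chi (levyOrder ν) y : ℂ)).congr
      (g := fun ξ => (chi (levyOrder ν) y : ℂ)
        * (Complex.exp ((inner ℝ x ((-2 * Real.pi) • ξ) : ℝ) * Complex.I)
          * ((inner ℝ y ((-2 * Real.pi) • ξ) : ℝ) * Complex.I * φ ξ)))
      (ae_of_all _ fun ξ => by ring)
    have i4 : Integrable fun ξ =>
        Complex.exp ((inner ℝ (x + y) ((-2 * Real.pi) • ξ) : ℝ) * Complex.I) * φ ξ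
        - Complex.exp ((inner ℝ x ((-2 * Real.pi) • ξ) : ℝ) * Complex.I) * φ ξ :=
      (i1 _).sub (i1 _)
    rw [levyIntegrand]
    push_cast
    rw [hφ.eq_integral, hφ.eq_integral, hφ.fderiv_eq_integral, ← integral_const_mul,
      ← integral_sub (i1 _) (i1 _), ← integral_sub i4 i3]
    refine integral_congr_ae (ae_of_all _ fun ξ => ?_)
    simp only [levySymbolIntegrand, inner_add_left, Complex.ofReal_add, add_mul, Complex.exp_add,
      Complex.real_smul]
    ring
  have h2 : (levyOp ν g x : ℂ) = ∫ y, ((levyIntegrand (levyOrder ν) g x y : ℝ) : ℂ) ∂ν :=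
    integral_complex_ofReal.symm
  rw [h2]
  simp_rw [h1]
  rw [integral_integral_swap]
  · refine integral_congr_ae (ae_of_all _ fun ξ => ?_)
    simp only
    rw [integral_const_mul, integral_mul_const]
    rfl
  · refine ((hρ.const_mul 6).mul_prod hφ.integrable).mono' ?_ (ae_of_all _ fun p => ?_)
    · have h3 := measurable_levySymbolIntegrand_smul (d := d) (levyOrder ν) (-2 * Real.pi)
      have h4 := hφ.measurable
      exact Measurable.aestronglyMeasurable (by fun_prop)
    · simp only [Function.uncurry]
      rw [norm_mul, Complex.norm_exp_ofReal_mul_I, one_mul, norm_mul]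
      refine (mul_le_mul_of_nonneg_right (norm_levySymbolIntegrand_le hα _ _)
        (norm_nonneg _)).trans (le_of_eq ?_)
      ring

/-- Integrating a superposition of characters against a probability measure multiplies the density
by the characteristic function. -/
lemma integral_superposition (μ : ProbabilityMeasure (EuclideanSpace ℝ (Fin d)))
    {Φ : EuclideanSpace ℝ (Fin d) → ℂ} (hΦ : Integrable Φ) (x : EuclideanSpace ℝ (Fin d)) :
    ∫ z, (∫ ξ, Complex.exp ((inner ℝ (x + z) ((-2 * Real.pi) • ξ) : ℝ) * Complex.I) * Φ ξ)
        ∂(μ : Measure (EuclideanSpace ℝ (Fin d)))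
      = ∫ ξ, Complex.exp ((inner ℝ x ((-2 * Real.pi) • ξ) : ℝ) * Complex.I)
        * (charFun (μ : Measure (EuclideanSpace ℝ (Fin d))) ((-2 * Real.pi) • ξ) * Φ ξ) := by
  rw [integral_integral_swap]
  · refine integral_congr_ae (ae_of_all _ fun ξ => ?_)
    simp only [charFun_apply]
    rw [integral_mul_const, ← mul_assoc, ← integral_const_mul]
    congr 2
    ext z
    rw [← Complex.exp_add, inner_add_left]
    push_cast
    ring_nf
  · have h1 : Integrable (fun p : EuclideanSpace ℝ (Fin d) × EuclideanSpace ℝ (Fin d) =>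
        Φ p.2) ((μ : Measure (EuclideanSpace ℝ (Fin d))).prod volume) := by
      simpa using (integrable_const (1 : ℂ)).mul_prod hΦ
        (μ := (μ : Measure (EuclideanSpace ℝ (Fin d))))
    refine h1.mono ((Continuous.aestronglyMeasurable (by fun_prop)).mul h1.1)
      (ae_of_all _ fun p => ?_)
    simp only [Function.uncurry]
    rw [norm_mul, Complex.norm_exp_ofReal_mul_I, one_mul]

/-- The **forward equation** for test functions. -/
lemma HasLevyLaws.forward_of_hasCompactSupport (hν : IsLevyMeasure ν)
    (hα : levyOrder ν ∈ Ioo (0 : ℝ) 2) (hρ : Integrable (levyEnvelope (levyOrder ν)) ν)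
    (hμ : HasLevyLaws ν μ)
    (hg : ContDiff ℝ ((⊤ : ℕ∞) : WithTop ℕ∞) g) (hc : HasCompactSupport g)
    {t : ℝ} (ht : 0 ≤ t) (x : EuclideanSpace ℝ (Fin d)) :
    ∫ z, g (x + z) ∂(μ t : Measure (EuclideanSpace ℝ (Fin d)))
      = g x + ∫ s in (0 : ℝ)..t,
        ∫ z, levyOp ν g (x + z) ∂(μ s : Measure (EuclideanSpace ℝ (Fin d))) := by
  obtain ⟨φ, hφ⟩ := exists_isFourierSuperposition hg hc
  have hψm : Measurable fun ξ => levySymbol ν ((-2 * Real.pi) • ξ) :=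
    (stronglyMeasurable_levySymbol hν).measurable.comp (by fun_prop)
  have hφm := hφ.measurable
  have hb1 : ∀ ξ : EuclideanSpace ℝ (Fin d), 1 ≤ 1 + ‖(-2 * Real.pi) • ξ‖ := fun ξ => by
    linarith [norm_nonneg ((-2 * Real.pi) • ξ)]
  have hφi : Integrable φ := by
    simpa using hφ.integrable_of_le (F := fun _ => 1) (by fun_prop) (C := 1) fun ξ => by
      rw [norm_one, one_mul]
      exact one_le_pow₀ (hb1 ξ)
  have hψi : Integrable fun ξ => levySymbol ν ((-2 * Real.pi) • ξ) * φ ξ :=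
    hφ.integrable_of_le hψm fun ξ => norm_levySymbol_le hα hρ _
  have hμ' : ∀ r ξ, charFun (μ r : Measure (EuclideanSpace ℝ (Fin d))) ξ
      = Complex.exp ((max r 0 : ℝ) * levySymbol ν ξ) := hμ
  -- The exponentials are characteristic functions, hence bounded by `1`.
  have hexp1 : ∀ s : ℝ, 0 ≤ s → ∀ ξ, ‖Complex.exp (s * levySymbol ν ξ)‖ ≤ 1 := by
    intro s hs ξ
    have := norm_charFun_le_one (μ := (μ s : Measure (EuclideanSpace ℝ (Fin d)))) ξ
    rwa [hμ', max_eq_left hs] at this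
  have hL : ∀ s : ℝ, 0 ≤ s →
      ((∫ z, levyOp ν g (x + z) ∂(μ s : Measure (EuclideanSpace ℝ (Fin d))) : ℝ) : ℂ)
      = ∫ ξ, Complex.exp ((inner ℝ x ((-2 * Real.pi) • ξ) : ℝ) * Complex.I)
        * (Complex.exp (s * levySymbol ν ((-2 * Real.pi) • ξ))
          * (levySymbol ν ((-2 * Real.pi) • ξ) * φ ξ)) := by
    intro s hs
    rw [← integral_complex_ofReal]
    simp_rw [hφ.levyOp_eq hν hα hρ]
    rw [integral_superposition _ hψi]
    simp_rw [hμ', max_eq_left hs]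
  have hG : ((∫ z, g (x + z) ∂(μ t : Measure (EuclideanSpace ℝ (Fin d))) : ℝ) : ℂ)
      = ∫ ξ, Complex.exp ((inner ℝ x ((-2 * Real.pi) • ξ) : ℝ) * Complex.I)
        * (Complex.exp (t * levySymbol ν ((-2 * Real.pi) • ξ)) * φ ξ) := by
    rw [← integral_complex_ofReal]
    simp_rw [hφ.eq_integral]
    rw [integral_superposition _ hφi]
    simp_rw [hμ', max_eq_left ht]
  have hR : ((∫ s in (0 : ℝ)..t,
        ∫ z, levyOp ν g (x + z) ∂(μ s : Measure (EuclideanSpace ℝ (Fin d))) : ℝ) : ℂ)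
      = ∫ ξ, Complex.exp ((inner ℝ x ((-2 * Real.pi) • ξ) : ℝ) * Complex.I)
        * ((Complex.exp (t * levySymbol ν ((-2 * Real.pi) • ξ)) - 1) * φ ξ) := by
    rw [← intervalIntegral.integral_ofReal, intervalIntegral.integral_of_le ht,
      setIntegral_congr_fun measurableSet_Ioc (fun s hs => hL s hs.1.le), integral_integral_swap]
    · refine integral_congr_ae (ae_of_all _ fun ξ => ?_)
      simp only
      rw [integral_const_mul]
      congr 1
      simp_rw [← mul_assoc]
      rw [integral_mul_const]
      congr 1
      rw [← intervalIntegral.integral_of_le ht]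
      have hd : ∀ s : ℝ, HasDerivAt
          (fun s : ℝ => Complex.exp (s * levySymbol ν ((-2 * Real.pi) • ξ)))
          (Complex.exp (s * levySymbol ν ((-2 * Real.pi) • ξ))
            * levySymbol ν ((-2 * Real.pi) • ξ)) s := by
        intro s
        have h1 : HasDerivAt (fun s : ℝ => (s : ℂ) * levySymbol ν ((-2 * Real.pi) • ξ))
            (levySymbol ν ((-2 * Real.pi) • ξ)) s := by
          simpa using (Complex.ofRealCLM.hasDerivAt (x := s)).mul_const
            (levySymbol ν ((-2 * Real.pi) • ξ))
        exact h1.cexp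
      rw [intervalIntegral.integral_eq_sub_of_hasDerivAt (fun s _ => hd s)
        (Continuous.intervalIntegrable (by fun_prop) _ _)]
      simp
    · have h1 : Integrable (fun p : ℝ × EuclideanSpace ℝ (Fin d) =>
          levySymbol ν ((-2 * Real.pi) • p.2) * φ p.2)
          ((volume.restrict (Ioc 0 t)).prod volume) := by
        simpa using (integrable_const (1 : ℂ)).mul_prod hψi (μ := volume.restrict (Ioc 0 t))
      have hψm' : Measurable fun p : ℝ × EuclideanSpace ℝ (Fin d) =>
          levySymbol ν ((-2 * Real.pi) • p.2) := hψm.comp measurable_snd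
      have h2 : ∀ᵐ p ∂((volume.restrict (Ioc 0 t)).prod
          (volume : Measure (EuclideanSpace ℝ (Fin d)))), 0 ≤ p.1 := by
        refine Measure.ae_prod_iff_ae_ae (measurableSet_le measurable_const measurable_fst) |>.2 ?_
        filter_upwards [ae_restrict_mem measurableSet_Ioc] with s hs
        exact ae_of_all _ fun _ => hs.1.le
      refine h1.mono (Measurable.aestronglyMeasurable ?_) ?_
      · unfold Function.uncurry
        fun_prop
      · filter_upwards [h2] with p hp
        simp only [Function.uncurry]
        rw [norm_mul, Complex.norm_exp_ofReal_mul_I, one_mul, norm_mul]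
        exact mul_le_of_le_one_left (norm_nonneg _) (hexp1 _ hp _)
  have hb : ∀ s : ℝ, 0 ≤ s → Integrable fun ξ =>
      Complex.exp ((inner ℝ x ((-2 * Real.pi) • ξ) : ℝ) * Complex.I)
        * (Complex.exp (s * levySymbol ν ((-2 * Real.pi) • ξ)) * φ ξ) := by
    intro s hs
    refine hφi.mono (Measurable.aestronglyMeasurable (by fun_prop)) (ae_of_all _ fun ξ => ?_)
    rw [norm_mul, Complex.norm_exp_ofReal_mul_I, one_mul, norm_mul]
    exact mul_le_of_le_one_left (norm_nonneg _) (hexp1 _ hs _)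
  have h0 := hb 0 le_rfl
  simp only [Complex.ofReal_zero, zero_mul, Complex.exp_zero, one_mul] at h0
  apply Complex.ofReal_injective
  push_cast
  rw [hG, hR, hφ.eq_integral, ← sub_eq_iff_eq_add', ← integral_sub (hb t ht) h0]
  refine integral_congr_ae (ae_of_all _ fun ξ => ?_)
  simp only
  ring

end Fourier

/-! ### The forward equation for bounded smooth functions -/

section Forward

variable {d : ℕ} {ν : Measure (EuclideanSpace ℝ (Fin d))}
  {μ : ℝ → ProbabilityMeasure (EuclideanSpace ℝ (Fin d))}

/-- A bounded smooth function is the limit of test functions, obtained by smooth cutoffs at larger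
and larger scales, with uniform bounds and with equality near each point eventually. -/
lemma IsC2Bounded.exists_seq_hasCompactSupport {C : ℝ} {g : EuclideanSpace ℝ (Fin d) → ℝ}
    (hg : IsC2Bounded C g) : ∃ (D : ℝ) (G : ℕ → EuclideanSpace ℝ (Fin d) → ℝ),
      (∀ n, HasCompactSupport (G n)) ∧ (∀ n, IsC2Bounded D (G n)) ∧
      ∀ x, ∀ᶠ n in atTop, G n =ᶠ[𝓝 x] g := by
  let η : ContDiffBump (0 : EuclideanSpace ℝ (Fin d)) := ⟨1, 2, one_pos, one_lt_two⟩
  obtain ⟨B, hB⟩ := IsC2Bounded.exists_of_hasCompactSupport (g := η) η.contDiff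
    η.hasCompactSupport
  let c : ℕ → ℝ := fun n => 1 / ((n : ℝ) + 1)
  have hc0 : ∀ n, 0 < c n := fun n => Nat.one_div_pos_of_nat
  have hc1 : ∀ n, c n ≤ 1 := fun n => by
    simp only [c]
    rw [div_le_one (by positivity)]
    linarith [(Nat.cast_nonneg n : (0 : ℝ) ≤ n)]
  refine ⟨4 * (B * C), fun n x => η (c n • x) * g x, fun n => ?_, fun n => ?_, fun x => ?_⟩
  · exact (η.hasCompactSupport.comp_smul (hc0 n).ne').mul_right
  · exact (hB.comp_smul (hc0 n).le (hc1 n)).mul hg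
  · have h1 : Tendsto (fun n => c n * (‖x‖ + 1)) atTop (𝓝 0) := by
      simpa [c] using (tendsto_one_div_add_atTop_nhds_zero_nat (𝕜 := ℝ)).mul_const (‖x‖ + 1)
    filter_upwards [h1.eventually_lt_const one_pos] with n hn
    have h2 : ∀ᶠ y in 𝓝 x, ‖y‖ < ‖x‖ + 1 :=
      continuous_norm.continuousAt.eventually_lt_const (by linarith)
    filter_upwards [h2] with y hy
    have h3 : η (c n • y) = 1 := by
      refine η.one_of_mem_closedBall ?_
      rw [mem_closedBall_zero_iff, norm_smul, Real.norm_of_nonneg (hc0 n).le]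
      exact (mul_le_mul_of_nonneg_left hy.le (hc0 n).le).trans hn.le
    rw [h3, one_mul]

lemma continuous_integral_levyLaws (hμ : HasLevyLaws ν μ) {h : EuclideanSpace ℝ (Fin d) → ℝ}
    (hh : Continuous h) {C : ℝ} (hC : ∀ x, ‖h x‖ ≤ C) :
    Continuous fun s => ∫ z, h z ∂(μ s : Measure (EuclideanSpace ℝ (Fin d))) :=
  continuous_integral_of_continuous_probabilityMeasure (h := fun _ z => h z) hμ.continuous
    (hh.comp continuous_snd) (fun _ => hC)

/-- The **forward equation** for bounded smooth functions. -/
theorem HasLevyLaws.forward (hν : IsLevyMeasure ν)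
    (hα : levyOrder ν ∈ Ioo (0 : ℝ) 2) (hρ : Integrable (levyEnvelope (levyOrder ν)) ν)
    (hμ : HasLevyLaws ν μ) {C : ℝ} {g : EuclideanSpace ℝ (Fin d) → ℝ} (hg : IsC2Bounded C g)
    {t : ℝ} (ht : 0 ≤ t) (x : EuclideanSpace ℝ (Fin d)) :
    ∫ z, g (x + z) ∂(μ t : Measure (EuclideanSpace ℝ (Fin d)))
      = g x + ∫ s in (0 : ℝ)..t,
        ∫ z, levyOp ν g (x + z) ∂(μ s : Measure (EuclideanSpace ℝ (Fin d))) := by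
  obtain ⟨D, G, hGc, hGb, hGg⟩ := hg.exists_seq_hasCompactSupport
  have hG1 : ∀ x, Tendsto (fun n => G n x) atTop (𝓝 (g x)) := fun x =>
    tendsto_const_nhds.congr' ((hGg x).mono fun n hn => hn.eq_of_nhds.symm)
  have hL : ∀ x, Tendsto (fun n => levyOp ν (G n) x) atTop (𝓝 (levyOp ν g x)) := fun x =>
    tendsto_levyOp hα hρ hGb (x := fun _ => x) (fun y => hG1 _)
      (tendsto_const_nhds.congr' ((hGg x).mono fun n hn => hn.fderiv_eq.symm))
  have hl : Tendsto (fun n => ∫ z, G n (x + z) ∂(μ t : Measure (EuclideanSpace ℝ (Fin d))))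
      atTop (𝓝 (∫ z, g (x + z) ∂(μ t : Measure (EuclideanSpace ℝ (Fin d))))) := by
    refine tendsto_integral_of_dominated_convergence (fun _ => D) (fun n => ?_)
      (integrable_const _) (fun n => ae_of_all _ fun z => (hGb n).norm_le _)
      (ae_of_all _ fun z => hG1 _)
    exact ((hGb n).contDiff.continuous.comp (by fun_prop)).aestronglyMeasurable
  have hLc : ∀ n, Continuous fun z => levyOp ν (G n) (x + z) := fun n =>
    ((hGb n).continuous_levyOp hα hρ).comp (by fun_prop)
  have hr : Tendsto (fun n => G n x + ∫ s in (0 : ℝ)..t,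
      ∫ z, levyOp ν (G n) (x + z) ∂(μ s : Measure (EuclideanSpace ℝ (Fin d)))) atTop
      (𝓝 (g x + ∫ s in (0 : ℝ)..t,
        ∫ z, levyOp ν g (x + z) ∂(μ s : Measure (EuclideanSpace ℝ (Fin d))))) := by
    refine (hG1 x).add ?_
    refine intervalIntegral.tendsto_integral_filter_of_dominated_convergence
      (fun _ => 4 * D * ∫ y, levyEnvelope (levyOrder ν) y ∂ν)
      (Eventually.of_forall fun n => ?_) (Eventually.of_forall fun n => ae_of_all _ fun s _ => ?_)
      intervalIntegrable_const (ae_of_all _ fun s _ => ?_)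
    · exact (continuous_integral_levyLaws hμ (hLc n)
        fun z => (hGb n).norm_levyOp_le hα hρ _).aestronglyMeasurable
    · refine (norm_integral_le_of_norm_le_const
        (ae_of_all _ fun z => (hGb n).norm_levyOp_le hα hρ (x + z))).trans ?_
      simp
    · refine tendsto_integral_of_dominated_convergence
        (fun _ => 4 * D * ∫ y, levyEnvelope (levyOrder ν) y ∂ν)
        (fun n => (hLc n).aestronglyMeasurable) (integrable_const _)
        (fun n => ae_of_all _ fun z => (hGb n).norm_levyOp_le hα hρ _)
        (ae_of_all _ fun z => hL _)
  refine tendsto_nhds_unique hl (hr.congr fun n => ?_)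
  exact (hμ.forward_of_hasCompactSupport hν hα hρ (hGb n).contDiff (hGc n) ht x).symm

end Forward

/-! ### Families of functions with uniformly bounded derivatives -/

section SmoothFamily

variable {d : ℕ}

/-- Needed to integrate iterated derivatives coordinatewise against weakly convergent laws. -/
instance finiteDimensional_continuousMultilinearMap (k : ℕ) :
    FiniteDimensional ℝ
      (ContinuousMultilinearMap ℝ (fun _ : Fin k => EuclideanSpace ℝ (Fin d)) ℝ) :=
  Module.Finite.of_injective
    (ContinuousMultilinearMap.toMultilinearMapLinear (R' := ℝ) (A := ℝ)
      (M₁ := fun _ : Fin k => EuclideanSpace ℝ (Fin d)) (M₂ := ℝ))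
    ContinuousMultilinearMap.toMultilinearMap_injective

/-- A family of smooth functions on `ℝᵈ`, indexed by a topological space, whose derivatives in the
space variable are jointly continuous and uniformly bounded. -/
structure IsSmoothFamily {A : Type*} [TopologicalSpace A]
    (F : A → EuclideanSpace ℝ (Fin d) → ℝ) : Prop where
  contDiff : ∀ a, ContDiff ℝ ((⊤ : ℕ∞) : WithTop ℕ∞) (F a)
  continuous : ∀ k : ℕ, Continuous fun p : A × EuclideanSpace ℝ (Fin d) =>
    iteratedFDeriv ℝ k (F p.1) p.2
  bounded : ∀ k : ℕ, ∃ C : ℝ, ∀ a x, ‖iteratedFDeriv ℝ k (F a) x‖ ≤ C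

variable {A B : Type*} [TopologicalSpace A] [TopologicalSpace B]
  {F : A → EuclideanSpace ℝ (Fin d) → ℝ}

lemma IsSmoothFamily.comp (hF : IsSmoothFamily F) {g : B → A} (hg : Continuous g) :
    IsSmoothFamily fun b => F (g b) where
  contDiff _ := hF.contDiff _
  continuous k := (hF.continuous k).comp ((hg.comp continuous_fst).prodMk continuous_snd)
  bounded k := (hF.bounded k).imp fun _ hC _ => hC _

lemma IsSmoothFamily.exists_isC2Bounded (hF : IsSmoothFamily F) :
    ∃ C, 0 ≤ C ∧ ∀ a, IsC2Bounded C (F a) := by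
  obtain ⟨C0, h0⟩ := hF.bounded 0
  obtain ⟨C1, h1⟩ := hF.bounded 1
  obtain ⟨C2, h2⟩ := hF.bounded 2
  exact ⟨max 0 (max C0 (max C1 C2)), le_max_left _ _, fun a =>
    IsC2Bounded.of_iteratedFDeriv (hF.contDiff a)
      (fun x => (h0 a x).trans (by simp)) (fun x => (h1 a x).trans (by simp))
      (fun x => (h2 a x).trans (by simp))⟩

lemma IsSmoothFamily.continuous_uncurry (hF : IsSmoothFamily F) :
    Continuous fun p : A × EuclideanSpace ℝ (Fin d) => F p.1 p.2 := by
  refine ((ContinuousMultilinearMap.apply ℝ (fun _ : Fin 0 => EuclideanSpace ℝ (Fin d)) ℝ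
    0).continuous.comp (hF.continuous 0)).congr fun p => ?_
  simp [ContinuousMultilinearMap.apply]

lemma IsSmoothFamily.continuous_fderiv_apply (hF : IsSmoothFamily F)
    (y : EuclideanSpace ℝ (Fin d)) :
    Continuous fun p : A × EuclideanSpace ℝ (Fin d) => fderiv ℝ (F p.1) p.2 y := by
  refine ((ContinuousMultilinearMap.apply ℝ (fun _ : Fin 1 => EuclideanSpace ℝ (Fin d)) ℝ
    fun _ => y).continuous.comp (hF.continuous 1)).congr fun p => ?_
  simp [ContinuousMultilinearMap.apply, iteratedFDeriv_one_apply]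

lemma IsSmoothFamily.continuous_fderiv (hF : IsSmoothFamily F) :
    Continuous fun p : A × EuclideanSpace ℝ (Fin d) => fderiv ℝ (F p.1) p.2 :=
  continuous_clm_apply.2 hF.continuous_fderiv_apply

lemma IsSmoothFamily.translate (hF : IsSmoothFamily F) :
    IsSmoothFamily fun (p : A × EuclideanSpace ℝ (Fin d)) x => F p.1 (x + p.2) where
  contDiff _ := (hF.contDiff _).comp (by fun_prop)
  continuous k := by
    simp_rw [iteratedFDeriv_comp_add_right]
    exact (hF.continuous k).comp (by fun_prop :
      Continuous fun q : (A × EuclideanSpace ℝ (Fin d)) × EuclideanSpace ℝ (Fin d) =>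
        (q.1.1, q.2 + q.1.2))
  bounded k := by
    obtain ⟨C, hC⟩ := hF.bounded k
    exact ⟨C, fun p x => by rw [iteratedFDeriv_comp_add_right]; exact hC _ _⟩

lemma IsSmoothFamily.const_mul (hF : IsSmoothFamily F) {c : A → ℝ} (hc : Continuous c) {K : ℝ}
    (hK : ∀ a, ‖c a‖ ≤ K) : IsSmoothFamily fun a x => c a * F a x := by
  have h : ∀ k a x, iteratedFDeriv ℝ k (fun x => c a * F a x) x
      = c a • iteratedFDeriv ℝ k (F a) x := fun k a x =>
    iteratedFDeriv_const_smul_apply (a := c a) (f := F a)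
      (((hF.contDiff a).of_le (by exact_mod_cast le_top)).contDiffAt)
  refine ⟨fun a => contDiff_const.mul (hF.contDiff a), fun k => ?_, fun k => ?_⟩
  · simp_rw [h]
    exact (hc.comp continuous_fst).smul (hF.continuous k)
  · obtain ⟨C, hC⟩ := hF.bounded k
    refine ⟨K * C, fun a x => ?_⟩
    rw [h, norm_smul]
    exact mul_le_mul (hK a) (hC a x) (norm_nonneg _) ((norm_nonneg _).trans (hK a))

/-! #### Integration over the parameter -/

section Integral

variable [MeasurableSpace A] [BorelSpace A]

lemma IsSmoothFamily.aestronglyMeasurable_iteratedFDeriv (hF : IsSmoothFamily F) (M : Measure A)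
    (k : ℕ) (x : EuclideanSpace ℝ (Fin d)) :
    AEStronglyMeasurable (fun a => iteratedFDeriv ℝ k (F a) x) M :=
  ((hF.continuous k).comp (continuous_id.prodMk continuous_const)).aestronglyMeasurable

lemma IsSmoothFamily.integrable_iteratedFDeriv (hF : IsSmoothFamily F) (M : Measure A)
    [IsFiniteMeasure M] (k : ℕ) (x : EuclideanSpace ℝ (Fin d)) :
    Integrable (fun a => iteratedFDeriv ℝ k (F a) x) M := by
  obtain ⟨C, hC⟩ := hF.bounded k
  exact Integrable.of_bound (hF.aestronglyMeasurable_iteratedFDeriv M k x) C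
    (ae_of_all _ fun a => hC a x)

/-- Differentiation of every order under the integral sign. -/
lemma IsSmoothFamily.hasFTaylorSeriesUpTo_integral (hF : IsSmoothFamily F) (M : Measure A)
    [IsFiniteMeasure M] :
    HasFTaylorSeriesUpTo ((⊤ : ℕ∞) : WithTop ℕ∞) (fun x => ∫ a, F a x ∂M)
      (fun x k => ∫ a, iteratedFDeriv ℝ k (F a) x ∂M) := by
  have hder : ∀ (k : ℕ) (x : EuclideanSpace ℝ (Fin d)),
      HasFDerivAt (fun x => ∫ a, iteratedFDeriv ℝ k (F a) x ∂M)
        (∫ a, iteratedFDeriv ℝ (k + 1) (F a) x ∂M).curryLeft x := by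
    intro k x
    have hcurry : ∀ a x, fderiv ℝ (iteratedFDeriv ℝ k (F a)) x
        = continuousMultilinearCurryLeftEquiv ℝ (fun _ => EuclideanSpace ℝ (Fin d)) ℝ
          (iteratedFDeriv ℝ (k + 1) (F a) x) := fun a x => by
      rw [iteratedFDeriv_succ_eq_comp_left]
      simp
    obtain ⟨C, hC⟩ := hF.bounded (k + 1)
    have h := hasFDerivAt_integral_of_dominated_of_fderiv_le (𝕜 := ℝ) (μ := M)
      (F := fun x a => iteratedFDeriv ℝ k (F a) x)
      (F' := fun x a => fderiv ℝ (iteratedFDeriv ℝ k (F a)) x) (x₀ := x)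
      (bound := fun _ => C) univ_mem
      (Eventually.of_forall fun x => hF.aestronglyMeasurable_iteratedFDeriv M k x)
      (hF.integrable_iteratedFDeriv M k x) ?_ (ae_of_all _ fun a y _ => ?_)
      (integrable_const _) (ae_of_all _ fun a y _ => ?_)
    · simp_rw [hcurry] at h
      have h2 := ContinuousLinearEquiv.integral_comp_comm (μ := M) (𝕜 := ℝ)
        (E := ContinuousMultilinearMap ℝ (fun _ : Fin (k + 1) => EuclideanSpace ℝ (Fin d)) ℝ)
        (F := EuclideanSpace ℝ (Fin d) →L[ℝ]
          ContinuousMultilinearMap ℝ (fun _ : Fin k => EuclideanSpace ℝ (Fin d)) ℝ)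
        (continuousMultilinearCurryLeftEquiv ℝ (fun _ : Fin (k + 1) => EuclideanSpace ℝ (Fin d))
          ℝ).toContinuousLinearEquiv (fun a => iteratedFDeriv ℝ (k + 1) (F a) x)
      simp only [LinearIsometryEquiv.coe_toContinuousLinearEquiv] at h2
      rw [h2] at h
      exact h
    · simp_rw [hcurry]
      exact (LinearIsometryEquiv.continuous _).comp_aestronglyMeasurable
        (hF.aestronglyMeasurable_iteratedFDeriv M (k + 1) x)
    · rw [hcurry, LinearIsometryEquiv.norm_map]
      exact hC a y
    · exact ((hF.contDiff a).differentiable_iteratedFDeriv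
        (by exact_mod_cast WithTop.coe_lt_top k) y).hasFDerivAt
  refine ⟨fun x => ?_, fun k _ x => hder k x, fun k _ => ?_⟩
  · have := ContinuousLinearEquiv.integral_comp_comm (μ := M)
      (continuousMultilinearCurryFin0 ℝ (EuclideanSpace ℝ (Fin d)) ℝ).toContinuousLinearEquiv
      (fun a => iteratedFDeriv ℝ 0 (F a) x)
    simp only [LinearIsometryEquiv.coe_toContinuousLinearEquiv] at this
    refine Eq.trans this.symm ?_
    simp [iteratedFDeriv_zero_eq_comp]
  · exact continuous_iff_continuousAt.2 fun x => (hder k x).continuousAt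

lemma IsSmoothFamily.iteratedFDeriv_integral (hF : IsSmoothFamily F) (M : Measure A)
    [IsFiniteMeasure M] (k : ℕ) (x : EuclideanSpace ℝ (Fin d)) :
    iteratedFDeriv ℝ k (fun x => ∫ a, F a x ∂M) x = ∫ a, iteratedFDeriv ℝ k (F a) x ∂M :=
  ((hF.hasFTaylorSeriesUpTo_integral M).eq_iteratedFDeriv (by exact_mod_cast le_top) x).symm

lemma IsSmoothFamily.fderiv_integral_apply (hF : IsSmoothFamily F) (M : Measure A)
    [IsFiniteMeasure M] (x y : EuclideanSpace ℝ (Fin d)) :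
    fderiv ℝ (fun x => ∫ a, F a x ∂M) x y = ∫ a, fderiv ℝ (F a) x y ∂M := by
  have h := (ContinuousMultilinearMap.apply ℝ (fun _ : Fin 1 => EuclideanSpace ℝ (Fin d)) ℝ
    fun _ => y).integral_comp_comm (hF.integrable_iteratedFDeriv M 1 x)
  rw [← hF.iteratedFDeriv_integral] at h
  simpa [ContinuousMultilinearMap.apply, iteratedFDeriv_one_apply] using h.symm

/-- A smooth family may be integrated over part of the parameters, provided that the measures
depend continuously enough on the remaining parameters. -/
lemma IsSmoothFamily.integral {F : B × A → EuclideanSpace ℝ (Fin d) → ℝ}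
    (hF : IsSmoothFamily F) {M : B → Measure A} [∀ b, IsFiniteMeasure (M b)] {K : ℝ}
    (hK : ∀ b, (M b).real univ ≤ K)
    (hcont : ∀ k, Continuous fun p : B × EuclideanSpace ℝ (Fin d) =>
      ∫ a, iteratedFDeriv ℝ k (F (p.1, a)) p.2 ∂(M p.1)) :
    IsSmoothFamily fun b x => ∫ a, F (b, a) x ∂(M b) := by
  have hFb : ∀ b, IsSmoothFamily fun a => F (b, a) := fun b => hF.comp (by fun_prop)
  refine ⟨fun b => ((hFb b).hasFTaylorSeriesUpTo_integral (M b)).contDiff, fun k => ?_,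
    fun k => ?_⟩
  · exact (hcont k).congr fun p => ((hFb p.1).iteratedFDeriv_integral (M p.1) k p.2).symm
  · obtain ⟨C, hC⟩ := hF.bounded k
    refine ⟨max C 0 * K, fun b x => ?_⟩
    rw [(hFb b).iteratedFDeriv_integral]
    refine (norm_integral_le_of_norm_le_const (C := max C 0)
      (ae_of_all _ fun a => (hC _ _).trans (le_max_left _ _))).trans ?_
    exact mul_le_mul_of_nonneg_left (hK b) (le_max_right _ _)

end Integral

/-! #### The Lévy operator on smooth families -/

section Operator

variable {ν : Measure (EuclideanSpace ℝ (Fin d))}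

lemma IsSmoothFamily.continuous_levyOp [FirstCountableTopology A]
    (hα : levyOrder ν ∈ Ioo (0 : ℝ) 2) (hρ : Integrable (levyEnvelope (levyOrder ν)) ν)
    (hF : IsSmoothFamily F) :
    Continuous fun p : A × EuclideanSpace ℝ (Fin d) => levyOp ν (F p.1) p.2 := by
  obtain ⟨C, -, hC⟩ := hF.exists_isC2Bounded
  refine continuous_iff_continuousAt.2 fun p => ?_
  refine tendsto_levyOp hα hρ (g := fun p : A × EuclideanSpace ℝ (Fin d) => F p.1)
    (x := fun p => p.2) (fun p => hC p.1) (fun y => ?_) ?_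
  · exact (hF.continuous_uncurry.comp (by fun_prop :
      Continuous fun p : A × EuclideanSpace ℝ (Fin d) => (p.1, p.2 + y))).tendsto p
  · exact hF.continuous_fderiv.tendsto p

/-- The Lévy operator commutes with integration over a parameter. -/
lemma IsSmoothFamily.levyOp_integral [MeasurableSpace A] [BorelSpace A]
    [SecondCountableTopology A] (hν : IsLevyMeasure ν)
    (hα : levyOrder ν ∈ Ioo (0 : ℝ) 2) (hρ : Integrable (levyEnvelope (levyOrder ν)) ν)
    (hF : IsSmoothFamily F) (M : Measure A) [IsFiniteMeasure M]
    (x : EuclideanSpace ℝ (Fin d)) :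
    levyOp ν (fun x => ∫ a, F a x ∂M) x = ∫ a, levyOp ν (F a) x ∂M := by
  have := sigmaFinite_of_isLevyMeasure hν
  obtain ⟨C, -, hC⟩ := hF.exists_isC2Bounded
  have hcF : ∀ x, Continuous fun a => F a x := fun x =>
    hF.continuous_uncurry.comp (by fun_prop : Continuous fun a : A => (a, x))
  have hi : ∀ x, Integrable (fun a => F a x) M := fun x =>
    Integrable.of_bound (hcF x).aestronglyMeasurable C (ae_of_all _ fun a => (hC a).norm_le x)
  have hcD : Continuous fun a => fderiv ℝ (F a) x :=
    hF.continuous_fderiv.comp (by fun_prop : Continuous fun a : A => (a, x))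
  have hiD : ∀ y, Integrable (fun a => fderiv ℝ (F a) x y) M := fun y =>
    Integrable.of_bound (hcD.clm_apply continuous_const).aestronglyMeasurable (C * ‖y‖)
      (ae_of_all _ fun a => ((fderiv ℝ (F a) x).le_opNorm y).trans (by
        gcongr
        exact (hC a).norm_fderiv_le x))
  have h1 : levyOp ν (fun x => ∫ a, F a x ∂M) x
      = ∫ y, ∫ a, levyIntegrand (levyOrder ν) (F a) x y ∂M ∂ν := by
    refine integral_congr_ae (ae_of_all _ fun y => ?_)
    simp only [levyIntegrand]
    have hi2 : Integrable (fun a => F a (x + y) - F a x) M := (hi _).sub (hi _)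
    rw [hF.fderiv_integral_apply, integral_sub hi2 ((hiD y).const_mul _),
      integral_sub (hi _) (hi _), integral_const_mul]
  rw [h1, integral_integral_swap]
  · rfl
  · have h2 : Integrable (fun p : EuclideanSpace ℝ (Fin d) × A =>
        4 * C * levyEnvelope (levyOrder ν) p.1) (ν.prod M) := by
      simpa using (hρ.const_mul (4 * C)).mul_prod (integrable_const (1 : ℝ)) (ν := M)
    refine h2.mono' (Measurable.aestronglyMeasurable ?_)
      (ae_of_all _ fun p => (hC p.2).norm_levyIntegrand_le hα x p.1)
    have m1 : Measurable fun p : EuclideanSpace ℝ (Fin d) × A => F p.2 (x + p.1) :=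
      (hF.continuous_uncurry.comp (by fun_prop :
        Continuous fun p : EuclideanSpace ℝ (Fin d) × A => (p.2, x + p.1))).measurable
    have m2 : Measurable fun p : EuclideanSpace ℝ (Fin d) × A => F p.2 x :=
      (hcF x).measurable.comp measurable_snd
    have m3 : Measurable fun p : EuclideanSpace ℝ (Fin d) × A => fderiv ℝ (F p.2) x p.1 :=
      ((hcD.comp continuous_snd).clm_apply continuous_fst).measurable
    have m4 : Measurable fun p : EuclideanSpace ℝ (Fin d) × A =>
        chi (levyOrder ν) p.1 := (measurable_chi _).comp measurable_fst
    exact (m1.sub m2).sub (m4.mul m3)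

/-- The semigroup acts on smooth families. -/
lemma IsSmoothFamily.semigroup [MeasurableSpace A] [BorelSpace A]
    [SecondCountableTopology A] [TopologicalSpace.PseudoMetrizableSpace A]
    {μ : ℝ → ProbabilityMeasure (EuclideanSpace ℝ (Fin d))} (hμ : HasLevyLaws ν μ)
    (hF : IsSmoothFamily F) :
    IsSmoothFamily fun (p : ℝ × A) x =>
      ∫ z, F p.2 (x + z) ∂(μ p.1 : Measure (EuclideanSpace ℝ (Fin d))) := by
  have hG : IsSmoothFamily fun (q : (ℝ × A) × EuclideanSpace ℝ (Fin d)) x => F q.1.2 (x + q.2) :=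
    hF.translate.comp (by fun_prop :
      Continuous fun q : (ℝ × A) × EuclideanSpace ℝ (Fin d) => (q.1.2, q.2))
  refine hG.integral (M := fun p : ℝ × A => (μ p.1 : Measure (EuclideanSpace ℝ (Fin d))))
    (K := 1) (fun b => by simp) fun k => ?_
  obtain ⟨C, hC⟩ := hF.bounded k
  simp_rw [iteratedFDeriv_comp_add_right]
  have h1 : Continuous fun q : ((ℝ × A) × EuclideanSpace ℝ (Fin d)) × EuclideanSpace ℝ (Fin d) =>
      iteratedFDeriv ℝ k (F q.1.1.2) (q.1.2 + q.2) :=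
    (hF.continuous k).comp (by fun_prop : Continuous fun
      q : ((ℝ × A) × EuclideanSpace ℝ (Fin d)) × EuclideanSpace ℝ (Fin d) =>
        (q.1.1.2, q.1.2 + q.2))
  have h2 : Continuous fun p : (ℝ × A) × EuclideanSpace ℝ (Fin d) => μ p.1.1 :=
    hμ.continuous.comp (by fun_prop)
  exact continuous_integral_of_continuous_probabilityMeasure h2 h1 fun p z => hC _ _

end Operator

/-! #### Smooth families indexed by a time interval -/

section Interval

variable {T : ℝ} {u : ℝ → EuclideanSpace ℝ (Fin d) → ℝ}

lemma isSmoothFamily_of_isCbInf (hu : IsCbInf T u) {g : A → ℝ} (hg : Continuous g)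
    (hgT : ∀ a, g a ∈ Icc (0 : ℝ) T) : IsSmoothFamily fun a => u (g a) where
  contDiff a := hu.contDiff _ (hgT a)
  continuous k := (hu.continuousOn k).comp_continuous
    (f := fun p : A × EuclideanSpace ℝ (Fin d) => (g p.1, p.2))
    ((hg.comp continuous_fst).prodMk continuous_snd) fun _ => ⟨hgT _, mem_univ _⟩
  bounded k := (hu.bounded k).imp fun _ hC a => hC _ (hgT a)

lemma isCbInf_of_isSmoothFamily (hu : IsSmoothFamily fun t : Icc (0 : ℝ) T => u t) :
    IsCbInf T u where
  contDiff t ht := hu.contDiff ⟨t, ht⟩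
  continuousOn k := by
    rw [continuousOn_iff_continuous_domRestrict]
    exact (hu.continuous k).comp (by fun_prop : Continuous fun
      p : ↥(Icc (0 : ℝ) T ×ˢ (univ : Set (EuclideanSpace ℝ (Fin d)))) =>
        ((⟨p.1.1, p.2.1⟩ : Icc (0 : ℝ) T), p.1.2))
  bounded k := (hu.bounded k).imp fun _ hC t ht => hC ⟨t, ht⟩

end Interval

end SmoothFamily

/-! ### The semigroup and Duhamel's integral -/

section Leibniz

/-- The **Leibniz rule** for an integral whose upper limit is the parameter: the chain rule on the
diagonal for `(a, b) ↦ ∫_0^a G b`, which has continuous partial derivatives. -/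
lemma hasDerivAt_integral_diagonal {G G' : ℝ → ℝ → ℝ}
    (hG : Continuous fun p : ℝ × ℝ => G p.1 p.2) (hG' : Continuous fun p : ℝ × ℝ => G' p.1 p.2)
    (hd : ∀ b s, HasDerivAt (fun b => G b s) (G' b s) b) (t : ℝ) :
    HasDerivAt (fun t => ∫ s in (0 : ℝ)..t, G t s) (G t t + ∫ s in (0 : ℝ)..t, G' t s) t := by
  have hG1 : ∀ b, Continuous (G b) := fun b =>
    hG.comp (by fun_prop : Continuous fun s : ℝ => (b, s))
  have hG1' : ∀ b, Continuous (G' b) := fun b =>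
    hG'.comp (by fun_prop : Continuous fun s : ℝ => (b, s))
  let f : ℝ → ℝ → ℝ := fun a b => ∫ s in (0 : ℝ)..a, G b s
  let f₁ : ℝ → ℝ → ℝ →L[ℝ] ℝ := fun a b => ContinuousLinearMap.toSpanSingleton ℝ (G b a)
  let f₂ : ℝ → ℝ → ℝ →L[ℝ] ℝ := fun a b =>
    ContinuousLinearMap.toSpanSingleton ℝ (∫ s in (0 : ℝ)..a, G' b s)
  have h1 : ∀ a b, HasFDerivAt (fun a => f a b) (f₁ a b) a := fun a b =>
    (intervalIntegral.integral_hasDerivAt_right ((hG1 b).intervalIntegrable _ _)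
      ((hG1 b).stronglyMeasurableAtFilter _ _) (hG1 b).continuousAt).hasFDerivAt
  have h2 : ∀ a b, HasFDerivAt (fun b => f a b) (f₂ a b) b := by
    intro a b
    obtain ⟨C, hC⟩ := ((isCompact_closedBall b 1).prod (isCompact_uIcc (a := (0 : ℝ))
      (b := a))).exists_bound_of_continuousOn hG'.continuousOn
    refine (intervalIntegral.hasDerivAt_integral_of_dominated_loc_of_deriv_le
      (F := G) (F' := G') (bound := fun _ => C) (Metric.closedBall_mem_nhds b one_pos)
      (Eventually.of_forall fun b => (hG1 b).aestronglyMeasurable)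
      ((hG1 b).intervalIntegrable _ _) (hG1' b).aestronglyMeasurable
      (ae_of_all _ fun s hs b' hb' => ?_) intervalIntegrable_const
      (ae_of_all _ fun s _ b' _ => hd b' s)).2.hasFDerivAt
    exact hC (b', s) ⟨hb', uIoc_subset_uIcc hs⟩
  have hspan : Continuous fun c : ℝ => ContinuousLinearMap.toSpanSingleton ℝ c := by
    refine continuous_clm_apply.2 fun y => ?_
    simp only [ContinuousLinearMap.toSpanSingleton_apply]
    fun_prop
  have c1 : Continuous fun p : ℝ × ℝ => f₁ p.1 p.2 :=
    hspan.comp (hG.comp (by fun_prop : Continuous fun p : ℝ × ℝ => (p.2, p.1)))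
  have c2 : Continuous fun p : ℝ × ℝ => f₂ p.1 p.2 := by
    refine hspan.comp ?_
    exact intervalIntegral.continuous_parametric_intervalIntegral_of_continuous
      (f := fun (p : ℝ × ℝ) s => G' p.2 s)
      (hG'.comp (by fun_prop : Continuous fun q : (ℝ × ℝ) × ℝ => (q.1.2, q.2))) continuous_fst
  have h3 := (hasStrictFDerivAt_uncurry_coprod (𝕜 := ℝ) (u := (t, t)) (f := f) (f₁ := f₁)
    (f₂ := f₂) (Eventually.of_forall fun v => h1 v.1 v.2)
    (Eventually.of_forall fun v => h2 v.1 v.2) c1.continuousAt c2.continuousAt).hasFDerivAt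
  have h4 : HasDerivAt (fun t : ℝ => (t, t)) ((1 : ℝ), (1 : ℝ)) t :=
    (hasDerivAt_id t).prodMk (hasDerivAt_id t)
  have h5 := HasFDerivAt.comp_hasDerivAt (x := t) (f := fun t : ℝ => (t, t)) h3 h4
  refine HasDerivAt.congr_deriv h5 ?_
  simp [f₁, f₂, Function.HasUncurry.uncurry]

end Leibniz

section Semigroup

variable {d : ℕ} {ν : Measure (EuclideanSpace ℝ (Fin d))}
  {μ : ℝ → ProbabilityMeasure (EuclideanSpace ℝ (Fin d))}

/-- The operator `(S_r g)(x) = ∫ g(x + z) μ_r(dz)`. -/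
def semigroupAction (μ : ℝ → ProbabilityMeasure (EuclideanSpace ℝ (Fin d)))
    (g : EuclideanSpace ℝ (Fin d) → ℝ) (r : ℝ) (x : EuclideanSpace ℝ (Fin d)) : ℝ :=
  ∫ z, g (x + z) ∂(μ r : Measure (EuclideanSpace ℝ (Fin d)))

lemma continuous_semigroupAction (hμ : HasLevyLaws ν μ) {h : ℝ → EuclideanSpace ℝ (Fin d) → ℝ}
    (hh : Continuous fun p : ℝ × EuclideanSpace ℝ (Fin d) => h p.1 p.2) {C : ℝ}
    (hC : ∀ s x, ‖h s x‖ ≤ C) :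
    Continuous fun q : (ℝ × ℝ) × EuclideanSpace ℝ (Fin d) =>
      semigroupAction μ (h q.1.2) q.1.1 q.2 := by
  have h1 : Continuous fun q : ((ℝ × ℝ) × EuclideanSpace ℝ (Fin d)) × EuclideanSpace ℝ (Fin d) =>
      h q.1.1.2 (q.1.2 + q.2) :=
    hh.comp (by fun_prop : Continuous fun
      q : ((ℝ × ℝ) × EuclideanSpace ℝ (Fin d)) × EuclideanSpace ℝ (Fin d) =>
        (q.1.1.2, q.1.2 + q.2))
  have h2 : Continuous fun p : (ℝ × ℝ) × EuclideanSpace ℝ (Fin d) => μ p.1.1 :=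
    hμ.continuous.comp (by fun_prop)
  exact continuous_integral_of_continuous_probabilityMeasure h2 h1 fun _ _ => hC _ _

lemma levyOp_comp_add_right (g : EuclideanSpace ℝ (Fin d) → ℝ) (x z : EuclideanSpace ℝ (Fin d)) :
    levyOp ν (fun x => g (x + z)) x = levyOp ν g (x + z) := by
  simp only [levyOp, fderiv_comp_add_right, add_right_comm]

lemma levyOp_const_mul {g : EuclideanSpace ℝ (Fin d) → ℝ} (hg : Differentiable ℝ g) (c : ℝ)
    (x : EuclideanSpace ℝ (Fin d)) :
    levyOp ν (fun x => c * g x) x = c * levyOp ν g x := by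
  simp only [levyOp]
  rw [← integral_const_mul]
  refine integral_congr_ae (ae_of_all _ fun y => ?_)
  simp only
  rw [fderiv_const_mul (hg x)]
  simp only [smul_apply, smul_eq_mul]
  ring

/-- The Lévy operator commutes with the semigroup. -/
lemma levyOp_semigroupAction (hν : IsLevyMeasure ν)
    (hα : levyOrder ν ∈ Ioo (0 : ℝ) 2) (hρ : Integrable (levyEnvelope (levyOrder ν)) ν)
    {f : ℝ → EuclideanSpace ℝ (Fin d) → ℝ} (hf : IsSmoothFamily f) (s r : ℝ)
    (x : EuclideanSpace ℝ (Fin d)) :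
    levyOp ν (semigroupAction μ (f s) r) x = semigroupAction μ (levyOp ν (f s)) r x := by
  have h1 : IsSmoothFamily fun (z : EuclideanSpace ℝ (Fin d)) x => f s (x + z) :=
    hf.translate.comp (by fun_prop : Continuous fun z : EuclideanSpace ℝ (Fin d) => (s, z))
  have h2 := h1.levyOp_integral hν hα hρ (μ r : Measure (EuclideanSpace ℝ (Fin d))) x
  simp_rw [levyOp_comp_add_right] at h2
  exact h2

variable {f : ℝ → EuclideanSpace ℝ (Fin d) → ℝ}

/-- The extension of `r ↦ (S_r g)(x)` to negative `r` by the right side of the forward equation. It is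
continuously differentiable on all of `ℝ`, while `semigroupAction` itself is constant for negative
`r`. -/
def semigroupExtension (ν : Measure (EuclideanSpace ℝ (Fin d)))
    (μ : ℝ → ProbabilityMeasure (EuclideanSpace ℝ (Fin d)))
    (g : EuclideanSpace ℝ (Fin d) → ℝ) (r : ℝ) (x : EuclideanSpace ℝ (Fin d)) : ℝ :=
  g x + ∫ q in (0 : ℝ)..r, semigroupAction μ (levyOp ν g) q x

lemma semigroupAction_eq_extension (hν : IsLevyMeasure ν)
    (hα : levyOrder ν ∈ Ioo (0 : ℝ) 2) (hρ : Integrable (levyEnvelope (levyOrder ν)) ν)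
    (hμ : HasLevyLaws ν μ) (hf : IsSmoothFamily f) (s : ℝ) {r : ℝ} (hr : 0 ≤ r)
    (x : EuclideanSpace ℝ (Fin d)) :
    semigroupAction μ (f s) r x = semigroupExtension ν μ (f s) r x := by
  obtain ⟨C, -, hC⟩ := hf.exists_isC2Bounded
  exact hμ.forward hν hα hρ (hC s) hr x

lemma continuous_semigroupAction_levyOp (hα : levyOrder ν ∈ Ioo (0 : ℝ) 2)
    (hρ : Integrable (levyEnvelope (levyOrder ν)) ν) (hμ : HasLevyLaws ν μ)
    (hf : IsSmoothFamily f) :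
    Continuous fun q : (ℝ × ℝ) × EuclideanSpace ℝ (Fin d) =>
      semigroupAction μ (levyOp ν (f q.1.2)) q.1.1 q.2 := by
  obtain ⟨C, -, hC⟩ := hf.exists_isC2Bounded
  exact continuous_semigroupAction hμ (hf.continuous_levyOp hα hρ)
    fun s x => (hC s).norm_levyOp_le hα hρ x

lemma continuous_semigroupAction_self (hμ : HasLevyLaws ν μ) (hf : IsSmoothFamily f) :
    Continuous fun q : (ℝ × ℝ) × EuclideanSpace ℝ (Fin d) =>
      semigroupAction μ (f q.1.2) q.1.1 q.2 := by
  obtain ⟨C, -, hC⟩ := hf.exists_isC2Bounded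
  exact continuous_semigroupAction hμ hf.continuous_uncurry fun s x => (hC s).norm_le x

lemma continuous_semigroupExtension (hα : levyOrder ν ∈ Ioo (0 : ℝ) 2)
    (hρ : Integrable (levyEnvelope (levyOrder ν)) ν) (hμ : HasLevyLaws ν μ)
    (hf : IsSmoothFamily f) (x : EuclideanSpace ℝ (Fin d)) :
    Continuous fun p : ℝ × ℝ => semigroupExtension ν μ (f p.2) p.1 x := by
  refine (hf.continuous_uncurry.comp (by fun_prop : Continuous fun p : ℝ × ℝ => (p.2, x))).add ?_
  exact intervalIntegral.continuous_parametric_intervalIntegral_of_continuous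
    (f := fun (p : ℝ × ℝ) q => semigroupAction μ (levyOp ν (f p.2)) q x)
    ((continuous_semigroupAction_levyOp hα hρ hμ hf).comp
      (by fun_prop : Continuous fun w : (ℝ × ℝ) × ℝ => ((w.2, w.1.2), x))) continuous_fst

lemma hasDerivAt_semigroupExtension (hα : levyOrder ν ∈ Ioo (0 : ℝ) 2)
    (hρ : Integrable (levyEnvelope (levyOrder ν)) ν) (hμ : HasLevyLaws ν μ)
    (hf : IsSmoothFamily f) (s r : ℝ) (x : EuclideanSpace ℝ (Fin d)) :
    HasDerivAt (fun r => semigroupExtension ν μ (f s) r x)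
      (semigroupAction μ (levyOp ν (f s)) r x) r := by
  have hc : Continuous fun q => semigroupAction μ (levyOp ν (f s)) q x :=
    (continuous_semigroupAction_levyOp hα hρ hμ hf).comp
      (by fun_prop : Continuous fun q : ℝ => ((q, s), x))
  exact (intervalIntegral.integral_hasDerivAt_right (hc.intervalIntegrable _ _)
    (hc.stronglyMeasurableAtFilter _ _) hc.continuousAt).const_add _

end Semigroup

section Duhamel

variable {d : ℕ} {ν : Measure (EuclideanSpace ℝ (Fin d))}
  {μ : ℝ → ProbabilityMeasure (EuclideanSpace ℝ (Fin d))}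
  {f : ℝ → EuclideanSpace ℝ (Fin d) → ℝ}

/-- Duhamel's integral `∫_0^t e^{-λ(t-s)} (S_{t-s} f_s)(x) ds`. -/
def duhamel (μ : ℝ → ProbabilityMeasure (EuclideanSpace ℝ (Fin d))) (lam : ℝ)
    (f : ℝ → EuclideanSpace ℝ (Fin d) → ℝ) (t : ℝ) (x : EuclideanSpace ℝ (Fin d)) : ℝ :=
  ∫ s in (0 : ℝ)..t, Real.exp (-lam * (t - s)) * semigroupAction μ (f s) (t - s) x

/-- The integrand of Duhamel's integral, as a smooth family over the two times. The exponent is frozen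
for `s > t`, so that the integrand is bounded. -/
lemma isSmoothFamily_duhamelIntegrand {lam : ℝ} (hlam : 0 ≤ lam) (hμ : HasLevyLaws ν μ)
    (hf : IsSmoothFamily f) :
    IsSmoothFamily fun (p : ℝ × ℝ) x =>
      Real.exp (-lam * max (p.1 - p.2) 0) * semigroupAction μ (f p.2) (p.1 - p.2) x := by
  refine ((hf.semigroup hμ).comp
    (by fun_prop : Continuous fun p : ℝ × ℝ => (p.1 - p.2, p.2))).const_mul
    (c := fun p : ℝ × ℝ => Real.exp (-lam * max (p.1 - p.2) 0)) (by fun_prop) (K := 1) fun p => ?_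
  rw [Real.norm_of_nonneg (Real.exp_pos _).le, Real.exp_le_one_iff]
  nlinarith [mul_nonneg hlam (le_max_right (p.1 - p.2) 0)]

lemma duhamel_eq_setIntegral (lam : ℝ) {t : ℝ} (ht : 0 ≤ t) (x : EuclideanSpace ℝ (Fin d)) :
    duhamel μ lam f t x = ∫ s in Ioc 0 t,
      Real.exp (-lam * max (t - s) 0) * semigroupAction μ (f s) (t - s) x := by
  rw [duhamel, intervalIntegral.integral_of_le ht]
  refine setIntegral_congr_fun measurableSet_Ioc fun s hs => ?_
  rw [max_eq_left (sub_nonneg.2 hs.2)]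

lemma isCbInf_duhamel {lam : ℝ} (hlam : 0 ≤ lam) (hμ : HasLevyLaws ν μ)
    (hf : IsSmoothFamily f) (T : ℝ) : IsCbInf T (duhamel μ lam f) := by
  refine isCbInf_of_isSmoothFamily ?_
  have h1 := (isSmoothFamily_duhamelIntegrand hlam hμ hf).comp
    (by fun_prop : Continuous fun p : Icc (0 : ℝ) T × ℝ => (p.1.1, p.2))
  have h2 : (fun (t : Icc (0 : ℝ) T) => duhamel μ lam f t) = fun t x => ∫ s in Ioc 0 t.1,
      Real.exp (-lam * max (t.1 - s) 0) * semigroupAction μ (f s) (t.1 - s) x := by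
    ext t x
    exact duhamel_eq_setIntegral lam t.2.1 x
  rw [h2]
  refine h1.integral (B := Icc (0 : ℝ) T) (M := fun t => volume.restrict (Ioc 0 t.1)) (K := T)
    (fun t => ?_) fun k => ?_
  · have := t.2.1
    have := t.2.2
    simp [*]
  · have h3 := intervalIntegral.continuous_parametric_intervalIntegral_of_continuous
      (μ := volume) (a₀ := 0) (X := Icc (0 : ℝ) T × EuclideanSpace ℝ (Fin d))
      (f := fun p s => iteratedFDeriv ℝ k (fun x => Real.exp (-lam * max (p.1.1 - s) 0)
        * semigroupAction μ (f s) (p.1.1 - s) x) p.2)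
      ((h1.continuous k).comp (by fun_prop : Continuous fun
        q : (Icc (0 : ℝ) T × EuclideanSpace ℝ (Fin d)) × ℝ => ((q.1.1, q.2), q.1.2)))
      (s := fun p => p.1.1) (by fun_prop)
    refine h3.congr fun p => ?_
    rw [intervalIntegral.integral_of_le p.1.2.1]

/-- Duhamel's integral solves the inhomogeneous equation. The Leibniz rule is applied with
`semigroupExtension`, since the integrand has to be differentiable across `s = t`. -/
lemma hasDerivWithinAt_duhamel (hν : IsLevyMeasure ν)
    (hα : levyOrder ν ∈ Ioo (0 : ℝ) 2) (hρ : Integrable (levyEnvelope (levyOrder ν)) ν)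
    {lam : ℝ} (hlam : 0 ≤ lam) (hμ : HasLevyLaws ν μ)
    (hf : IsSmoothFamily f) {t : ℝ} (ht : 0 ≤ t) (x : EuclideanSpace ℝ (Fin d)) :
    HasDerivWithinAt (fun t => duhamel μ lam f t x)
      (levyOp ν (duhamel μ lam f t) x - lam * duhamel μ lam f t x + f t x) (Ici 0) t := by
  let G : ℝ → ℝ → ℝ := fun b s =>
    Real.exp (-lam * (b - s)) * semigroupExtension ν μ (f s) (b - s) x
  let G' : ℝ → ℝ → ℝ := fun b s =>
    Real.exp (-lam * (b - s)) * semigroupAction μ (levyOp ν (f s)) (b - s) x - lam * G b s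
  have hG : Continuous fun p : ℝ × ℝ => G p.1 p.2 :=
    (by fun_prop : Continuous fun p : ℝ × ℝ => Real.exp (-lam * (p.1 - p.2))).mul
      ((continuous_semigroupExtension hα hρ hμ hf x).comp
        (by fun_prop : Continuous fun p : ℝ × ℝ => (p.1 - p.2, p.2)))
  have hPL : Continuous fun p : ℝ × ℝ =>
      Real.exp (-lam * (p.1 - p.2)) * semigroupAction μ (levyOp ν (f p.2)) (p.1 - p.2) x :=
    (by fun_prop : Continuous fun p : ℝ × ℝ => Real.exp (-lam * (p.1 - p.2))).mul
      ((continuous_semigroupAction_levyOp hα hρ hμ hf).comp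
        (by fun_prop : Continuous fun p : ℝ × ℝ => ((p.1 - p.2, p.2), x)))
  have hG' : Continuous fun p : ℝ × ℝ => G' p.1 p.2 := hPL.sub (hG.const_mul lam)
  have hd : ∀ b s, HasDerivAt (fun b => G b s) (G' b s) b := by
    intro b s
    have h1 : HasDerivAt (fun b => b - s) 1 b := (hasDerivAt_id b).sub_const s
    have h2 : HasDerivAt (fun b => semigroupExtension ν μ (f s) (b - s) x)
        (semigroupAction μ (levyOp ν (f s)) (b - s) x) b := by
      have h3 := (hasDerivAt_semigroupExtension hα hρ hμ hf s (b - s) x).comp b h1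
      rw [mul_one] at h3
      exact h3
    refine HasDerivAt.congr_deriv (((h1.const_mul (-lam)).exp).mul h2) ?_
    simp only [G', G]
    ring
  have hu : ∀ t, 0 ≤ t → duhamel μ lam f t x = ∫ s in (0 : ℝ)..t, G t s := by
    intro t ht
    refine intervalIntegral.integral_congr fun s hs => ?_
    rw [uIcc_of_le ht] at hs
    simp only [G]
    rw [semigroupAction_eq_extension hν hα hρ hμ hf s (sub_nonneg.2 hs.2)]
  have hGt : G t t = f t x := by simp [G, semigroupExtension]
  have hL : levyOp ν (duhamel μ lam f t) x = ∫ s in (0 : ℝ)..t,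
      Real.exp (-lam * (t - s)) * semigroupAction μ (levyOp ν (f s)) (t - s) x := by
    have h1 := (isSmoothFamily_duhamelIntegrand hlam hμ hf).comp
      (by fun_prop : Continuous fun s : ℝ => (t, s))
    have h2 : duhamel μ lam f t = fun x => ∫ s in Ioc 0 t,
        Real.exp (-lam * max (t - s) 0) * semigroupAction μ (f s) (t - s) x := by
      ext x
      exact duhamel_eq_setIntegral lam ht x
    have h3 := h1.levyOp_integral hν hα hρ (volume.restrict (Ioc 0 t)) x
    rw [h2, h3, intervalIntegral.integral_of_le ht]
    refine setIntegral_congr_fun measurableSet_Ioc fun s hs => ?_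
    have hdiff : Differentiable ℝ (semigroupAction μ (f s) (t - s)) :=
      ((hf.semigroup hμ).contDiff (t - s, s)).differentiable (by simp)
    simp only
    rw [levyOp_const_mul hdiff, levyOp_semigroupAction hν hα hρ hf,
      max_eq_left (sub_nonneg.2 hs.2)]
  have h4 := (hasDerivAt_integral_diagonal hG hG' hd t).hasDerivWithinAt (s := Ici 0)
  have h5 := h4.congr_of_mem (fun t ht => hu t ht) ht
  refine h5.congr_deriv ?_
  have hPLt : Continuous fun s : ℝ =>
      Real.exp (-lam * (t - s)) * semigroupAction μ (levyOp ν (f s)) (t - s) x :=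
    hPL.comp (by fun_prop : Continuous fun s : ℝ => (t, s))
  have hGtc : Continuous fun s : ℝ => lam * G t s :=
    (hG.comp (by fun_prop : Continuous fun s : ℝ => (t, s))).const_mul lam
  simp only [G']
  rw [hGt, hL, hu t ht, intervalIntegral.integral_sub (hPLt.intervalIntegrable _ _)
    (hGtc.intervalIntegrable _ _), intervalIntegral.integral_const_mul]
  ring

/-- Every solution is given by Duhamel's integral: the derivative of `s ↦ e^{-λ(t-s)} S_{t-s} v_s`
is `e^{-λ(t-s)} S_{t-s} f_s`. -/
lemma eq_duhamel_of_hasDerivAt (hν : IsLevyMeasure ν)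
    (hα : levyOrder ν ∈ Ioo (0 : ℝ) 2) (hρ : Integrable (levyEnvelope (levyOrder ν)) ν)
    {lam : ℝ} (hμ : HasLevyLaws ν μ) (hf : IsSmoothFamily f)
    {v : ℝ → EuclideanSpace ℝ (Fin d) → ℝ} (hv : IsSmoothFamily v) {T : ℝ}
    (hvd : ∀ t ∈ Ioo 0 T, ∀ x, HasDerivAt (fun s => v s x)
      (levyOp ν (v t) x - lam * v t x + f t x) t) (hv0 : ∀ x, v 0 x = 0)
    {t : ℝ} (ht : t ∈ Icc 0 T) (x : EuclideanSpace ℝ (Fin d)) :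
    v t x = duhamel μ lam f t x := by
  obtain ⟨Cv, hCv0, hCv⟩ := hv.exists_isC2Bounded
  obtain ⟨Cf, hCf0, hCf⟩ := hf.exists_isC2Bounded
  let h : ℝ → EuclideanSpace ℝ (Fin d) → ℝ := fun s x =>
    levyOp ν (v s) x - lam * v s x + f s x
  have hLc := hv.continuous_levyOp hα hρ
  have hhc : Continuous fun p : ℝ × EuclideanSpace ℝ (Fin d) => h p.1 p.2 :=
    (hLc.sub (hv.continuous_uncurry.const_mul lam)).add hf.continuous_uncurry
  obtain ⟨Ch, hCh⟩ : ∃ Ch, ∀ s x, ‖h s x‖ ≤ Ch := by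
    refine ⟨4 * Cv * ∫ y, levyEnvelope (levyOrder ν) y ∂ν + |lam| * Cv + Cf, fun s x => ?_⟩
    refine (norm_add_le _ _).trans (add_le_add ((norm_sub_le _ _).trans (add_le_add
      ((hCv s).norm_levyOp_le hα hρ x) ?_)) ((hCf s).norm_le x))
    rw [norm_mul, Real.norm_eq_abs]
    gcongr
    exact (hCv s).norm_le x
  have hcx : ∀ (g : ℝ → EuclideanSpace ℝ (Fin d) → ℝ),
      (Continuous fun p : ℝ × EuclideanSpace ℝ (Fin d) => g p.1 p.2) → ∀ s,
      Continuous fun z => g s (x + z) := fun g hg s =>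
    hg.comp (by fun_prop : Continuous fun z : EuclideanSpace ℝ (Fin d) => (s, x + z))
  have hsplit : ∀ a b, semigroupAction μ (h b) a x = semigroupAction μ (levyOp ν (v b)) a x
      - lam * semigroupAction μ (v b) a x + semigroupAction μ (f b) a x := by
    intro a b
    have i1 : Integrable (fun z => levyOp ν (v b) (x + z))
        (μ a : Measure (EuclideanSpace ℝ (Fin d))) :=
      Integrable.of_bound (hcx (fun s => levyOp ν (v s)) hLc b).aestronglyMeasurable _
        (ae_of_all _ fun z => (hCv b).norm_levyOp_le hα hρ _)
    have i2 : Integrable (fun z => lam * v b (x + z))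
        (μ a : Measure (EuclideanSpace ℝ (Fin d))) :=
      (Integrable.of_bound (hcx v hv.continuous_uncurry b).aestronglyMeasurable _
        (ae_of_all _ fun z => (hCv b).norm_le _)).const_mul lam
    have i3 : Integrable (fun z => f b (x + z)) (μ a : Measure (EuclideanSpace ℝ (Fin d))) :=
      Integrable.of_bound (hcx f hf.continuous_uncurry b).aestronglyMeasurable _
        (ae_of_all _ fun z => (hCf b).norm_le _)
    have i4 : Integrable (fun z => levyOp ν (v b) (x + z) - lam * v b (x + z))
        (μ a : Measure (EuclideanSpace ℝ (Fin d))) := i1.sub i2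
    simp only [semigroupAction, h]
    rw [integral_add i4 i3, integral_sub i1 i2, integral_const_mul]
  let H : ℝ → ℝ → ℝ := fun a b => Real.exp (-lam * a) * semigroupAction μ (v b) a x
  let H₁ : ℝ → ℝ → ℝ := fun a b => Real.exp (-lam * a) * semigroupAction μ (levyOp ν (v b)) a x
    - lam * H a b
  let H₂ : ℝ → ℝ → ℝ := fun a b => Real.exp (-lam * a) * semigroupAction μ (h b) a x
  have hexp : Continuous fun p : ℝ × ℝ => Real.exp (-lam * p.1) := by fun_prop
  have hpt : Continuous fun p : ℝ × ℝ => (p, x) := by fun_prop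
  have cH : Continuous fun p : ℝ × ℝ => H p.1 p.2 :=
    hexp.mul ((continuous_semigroupAction_self hμ hv).comp hpt)
  have cH₁ : Continuous fun p : ℝ × ℝ => H₁ p.1 p.2 :=
    (hexp.mul ((continuous_semigroupAction_levyOp hα hρ hμ hv).comp hpt)).sub (cH.const_mul lam)
  have cH₂ : Continuous fun p : ℝ × ℝ => H₂ p.1 p.2 :=
    hexp.mul ((continuous_semigroupAction hμ hhc hCh).comp hpt)
  -- `H a b = e^{-λa} (S_a v_b)(x)`; its partial derivatives are continuous, and the chain rule along
  -- `s ↦ (t - s, s)` makes the terms with `L^ν` and `λ` cancel.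
  have d₁ : ∀ a b, 0 < a → HasDerivAt (fun a => H a b) (H₁ a b) a := by
    intro a b ha
    have h1 : HasDerivAt (fun a => semigroupAction μ (v b) a x)
        (semigroupAction μ (levyOp ν (v b)) a x) a := by
      refine (hasDerivAt_semigroupExtension hα hρ hμ hv b a x).congr_of_eventuallyEq ?_
      filter_upwards [lt_mem_nhds ha] with r hr
      exact semigroupAction_eq_extension hν hα hρ hμ hv b hr.le x
    refine HasDerivAt.congr_deriv ((((hasDerivAt_id a).const_mul (-lam)).exp).mul h1) ?_
    simp only [H₁, H, id]
    ring
  have d₂ : ∀ a, ∀ b ∈ Ioo 0 T, HasDerivAt (fun b => H a b) (H₂ a b) b := by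
    intro a b hb
    refine HasDerivAt.const_mul _ ?_
    exact (hasDerivAt_integral_of_dominated_loc_of_deriv_le
      (F := fun b z => v b (x + z)) (F' := fun b z => h b (x + z)) (bound := fun _ => Ch)
      (Ioo_mem_nhds hb.1 hb.2)
      (Eventually.of_forall fun b => (hcx v hv.continuous_uncurry b).aestronglyMeasurable)
      (Integrable.of_bound (hcx v hv.continuous_uncurry b).aestronglyMeasurable _
        (ae_of_all _ fun z => (hCv b).norm_le _))
      (hcx h hhc b).aestronglyMeasurable (ae_of_all _ fun z b _ => hCh _ _)
      (integrable_const _) (ae_of_all _ fun z b hb => hvd b hb _)).2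
  have hspan : Continuous fun c : ℝ => ContinuousLinearMap.toSpanSingleton ℝ c := by
    refine continuous_clm_apply.2 fun y => ?_
    simp only [ContinuousLinearMap.toSpanSingleton_apply]
    fun_prop
  have dΦ : ∀ s ∈ Ioo 0 t, HasDerivAt (fun s => H (t - s) s)
      (Real.exp (-lam * (t - s)) * semigroupAction μ (f s) (t - s) x) s := by
    intro s hs
    have hs1 : ∀ᶠ p : ℝ × ℝ in 𝓝 (t - s, s), 0 < p.1 :=
      continuousAt_fst.eventually_const_lt (by simpa using hs.2)
    have hs2 : ∀ᶠ p : ℝ × ℝ in 𝓝 (t - s, s), p.2 ∈ Ioo 0 T :=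
      continuousAt_snd.eventually_mem (Ioo_mem_nhds hs.1 (hs.2.trans_le ht.2))
    have h3 := (hasStrictFDerivAt_uncurry_coprod (𝕜 := ℝ) (u := (t - s, s)) (f := H)
      (f₁ := fun a b => ContinuousLinearMap.toSpanSingleton ℝ (H₁ a b))
      (f₂ := fun a b => ContinuousLinearMap.toSpanSingleton ℝ (H₂ a b))
      (hs1.mono fun p hp => (d₁ p.1 p.2 hp).hasFDerivAt)
      (hs2.mono fun p hp => (d₂ p.1 p.2 hp).hasFDerivAt)
      (hspan.comp cH₁).continuousAt (hspan.comp cH₂).continuousAt).hasFDerivAt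
    have h4 : HasDerivAt (fun s : ℝ => (t - s, s)) ((-1 : ℝ), (1 : ℝ)) s :=
      ((hasDerivAt_id s).const_sub t).prodMk (hasDerivAt_id s)
    have h5 := HasFDerivAt.comp_hasDerivAt (x := s) (f := fun s : ℝ => (t - s, s)) h3 h4
    refine HasDerivAt.congr_deriv h5 ?_
    simp only [ContinuousLinearMap.coprod_apply, Function.HasUncurry.uncurry, id,
      ContinuousLinearMap.toSpanSingleton_apply, smul_eq_mul, H₁, H₂, H, hsplit]
    ring
  have hcf : Continuous fun s =>
      Real.exp (-lam * (t - s)) * semigroupAction μ (f s) (t - s) x :=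
    (by fun_prop : Continuous fun s => Real.exp (-lam * (t - s))).mul
      ((continuous_semigroupAction_self hμ hf).comp
        (by fun_prop : Continuous fun s : ℝ => ((t - s, s), x)))
  have hFTC := intervalIntegral.integral_eq_sub_of_hasDerivAt_of_le ht.1
    (cH.comp (by fun_prop : Continuous fun s : ℝ => (t - s, s))).continuousOn dΦ
    (hcf.intervalIntegrable _ _)
  have hH0 : H (t - 0) 0 = 0 := by simp [H, semigroupAction, hv0]
  have hHt : H (t - t) t = v t x := by
    simp only [H, sub_self]
    rw [semigroupAction_eq_extension hν hα hρ hμ hv t le_rfl x]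
    simp [semigroupExtension]
  rw [duhamel, hFTC]
  simp only [Function.comp]
  rw [hH0, hHt, sub_zero]

end Duhamel

/-! ### The Cauchy problem -/

/-- A function in `C_b^∞(H_T)`, frozen in time outside `[0, T]`, is a smooth family over `ℝ`. -/
lemma LevyCauchy.IsCbInf.isSmoothFamily_clamp {d : ℕ} {T : ℝ} (hT : 0 ≤ T)
    {u : ℝ → EuclideanSpace ℝ (Fin d) → ℝ} (hu : IsCbInf T u) :
    IsSmoothFamily fun s => u (max 0 (min s T)) :=
  isSmoothFamily_of_isCbInf hu (by fun_prop)
    fun _ => ⟨le_max_left _ _, max_le hT (min_le_right _ _)⟩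

/-- The one-dimensional marginal laws of a Lévy process, frozen for negative times. -/
def marginalLaws {d : ℕ} {Ω : Type*} [MeasurableSpace Ω] (P : Measure Ω) [IsProbabilityMeasure P]
    (Z : ℝ → Ω → EuclideanSpace ℝ (Fin d)) (hZ : ∀ t, 0 ≤ t → AEMeasurable (Z t) P) (r : ℝ) :
    ProbabilityMeasure (EuclideanSpace ℝ (Fin d)) :=
  ⟨P.map (Z (max r 0)), Measure.isProbabilityMeasure_map (hZ _ (le_max_right _ _))⟩

end

theorem mainTheorem8 {d : ℕ} {Ω : Type*} [MeasurableSpace Ω] (P : Measure Ω)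
    [IsProbabilityMeasure P]
    -- the Lévy measure, its order, and the integrability without which `L^ν` and `Z^ν` do not exist
    (ν : Measure (EuclideanSpace ℝ (Fin d))) (hν : IsLevyMeasure ν)
    (hα : levyOrder ν ∈ Ioo (0 : ℝ) 2)
    (hν_large : 1 < levyOrder ν →
      ∫⁻ y in {y : EuclideanSpace ℝ (Fin d) | 1 < ‖y‖}, ENNReal.ofReal ‖y‖ ∂ν < ∞)
    -- the Poisson random measure and the Lévy process associated with `ν`
    (J : Ω → Measure (ℝ × EuclideanSpace ℝ (Fin d))) (Z : ℝ → Ω → EuclideanSpace ℝ (Fin d))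
    (hZ : IsLevyProcessOf P ν J Z)
    -- the data of the generalized Besov norm
    (w l : ℝ → ℝ) (hw : IsScalingFunction w l)
    (N : ℝ) (hN : 3 < N) (hlN : l N⁻¹ < 1) (hlN' : 1 < l N)
    (ϕ : EuclideanSpace ℝ (Fin d) → ℝ) (hϕ : IsLittlewoodPaley N ϕ)
    (β : ℝ) (hβ : 0 < β) (T : ℝ) (hT : 0 < T) (lam : ℝ) (hlam : 0 ≤ lam)
    (f : ℝ → EuclideanSpace ℝ (Fin d) → ℝ) (hf : IsCbInf T f)
    (hfβ : besovNorm w N ϕ β T f < ∞) :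
    ∃ u : ℝ → EuclideanSpace ℝ (Fin d) → ℝ,
      IsCbInf T u ∧ IsSolution ν lam T f u ∧
      (∀ v : ℝ → EuclideanSpace ℝ (Fin d) → ℝ, IsCbInf T v → IsSolution ν lam T f v →
        ∀ t ∈ Icc (0 : ℝ) T, ∀ x, v t x = u t x) ∧
      ∀ t ∈ Icc (0 : ℝ) T, ∀ x,
        u t x = ∫ s in (0 : ℝ)..t, Real.exp (-lam * (t - s)) * ∫ ω, f s (x + Z (t - s) ω) ∂P := by
  have hρ := integrable_levyEnvelope hν hα hν_large
  let μ := marginalLaws P Z hZ.aemeasurable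
  have hμ : HasLevyLaws ν μ := fun r ξ =>
    charFun_levyProcess hν hα hρ hZ (le_max_right r 0) ξ
  have hclamp : ∀ s ∈ Icc 0 T, max 0 (min s T) = s := fun s hs => by
    rw [min_eq_left hs.2, max_eq_right hs.1]
  have hfs := hf.isSmoothFamily_clamp hT.le
  refine ⟨duhamel μ lam fun s => f (max 0 (min s T)), isCbInf_duhamel hlam hμ hfs T,
    ⟨fun t ht x => ?_, fun x => by simp [duhamel]⟩, fun v hv hvs t ht x => ?_,
    fun t ht x => ?_⟩
  · have h1 := (hasDerivWithinAt_duhamel hν hα hρ hlam hμ hfs ht.1 x).mono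
      (Icc_subset_Ici_self : Icc 0 T ⊆ Ici 0)
    simpa only [hclamp t ht] using h1
  · have hvc := hv.isSmoothFamily_clamp hT.le
    have h1 := eq_duhamel_of_hasDerivAt hν hα hρ (lam := lam) hμ hfs hvc (T := T)
      (fun s hs y => ?_)
      (fun y => by rw [hclamp 0 (left_mem_Icc.2 hT.le)]; exact hvs.initial y) ht x
    · simpa only [hclamp t ht] using h1
    · have hs' : s ∈ Icc 0 T := Ioo_subset_Icc_self hs
      simp only [hclamp s hs']
      refine ((hvs.hasDeriv s hs' y).hasDerivAt (Icc_mem_nhds hs.1 hs.2)).congr_of_eventuallyEq ?_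
      filter_upwards [Icc_mem_nhds hs.1 hs.2] with r hr
      rw [hclamp r hr]
  · refine intervalIntegral.integral_congr fun s hs => ?_
    rw [uIcc_of_le ht.1] at hs
    have hs' : s ∈ Icc 0 T := ⟨hs.1, hs.2.trans ht.2⟩
    have hcont : Continuous fun z => f s (x + z) :=
      (hf.contDiff s hs').continuous.comp (by fun_prop)
    have h1 : semigroupAction μ (f s) (t - s) x = ∫ ω, f s (x + Z (t - s) ω) ∂P := by
      have h2 : (μ (t - s) : Measure (EuclideanSpace ℝ (Fin d))) = P.map (Z (t - s)) := by
        change P.map (Z (max (t - s) 0)) = _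
        rw [max_eq_left (sub_nonneg.2 hs.2)]
      rw [semigroupAction, h2, integral_map (hZ.aemeasurable _ (sub_nonneg.2 hs.2))
        hcont.aestronglyMeasurable]
    simp only [hclamp s hs', h1]
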